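/- Let $n\ge 0$ and let $\Lambda=\mathrm{diag}(d_1,\dots,d_n)$ be a traceless complex diagonal matrix with pairwise distinct $d_i$. Write $X^g=gXg^{-1}$ and let $\mathcal O=\{\Lambda^g : g\in \mathrm{SL}_n(\mathbb C)\}$. Let $K=\mathrm{SU}(n)$, let $\mathsf U$ be the group of upper triangular complex matrices of determinant one with positive real diagonal entries, let $L$ be the group of lower triangular complex matrices with all diagonal entries equal to $1$, and let $\mathfrak l$ be the space of strictly lower triangular complex matrices. Put $$\mathcal C=\{k\in K : k=lu \text{ for some } l\in L,\,u\in \mathsf U\},\qquad \mathcal D=\{u\in \mathsf U : l=ku \text{ for some } l\in L,\,k\in K\},$$ $$\Phi_{\mathcal C}:\mathcal C\times L\to\mathcal O,\ (k,l)\mapsto \Lambda^{(lk)^{-1}},\qquad \Phi_{\mathcal D}:\mathcal D\times L\to\mathcal O,\ (u,l)\mapsto \Lambda^{ul^{-1}}.$$ A map between subsets of real normed spaces is called real analytic if near each point of its domain it is the restriction of a real analytic map defined on a neighbourhood in the ambient space; a real analytic diffeomorphism is a bijection that is real analytic together with its inverse. Then $\Phi_{\mathcal C}$ and $\Phi_{\mathcal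 D}$ are injective and have the same image $\mathcal U$, which is an open dense subset of $\mathcal O$ and contains $\Lambda+\mathfrak l$; the map $l\mapsto\Lambda^{l^{-1}}$ is a bijection $L\to\Lambda+\mathfrak l$; and every $l\in L$ is uniquely a product $l=ku$ with $k\in\mathcal C$, $u\in\mathcal D$. Hence the map $$\varphi:\mathcal U\to(\Lambda+\mathfrak l)\times(\Lambda+\mathfrak l),\qquad X=\Lambda^{(l_1k)^{-1}}=\Lambda^{ul_2^{-1}}\mapsto (Y,Z)=(\Lambda^{l_1^{-1}},\Lambda^{l_2^{-1}})\qquad(l_1,l_2\in L,\ k\in\mathcal C,\ u\in\mathcal D),$$ is well defined. Moreover: 1. $\varphi$ is a real analytic diffeomorphism, with inverse $(Y=\Lambda^{l_1^{-1}},Z=\Lambda^{l_2^{-1}})\mapsto Y^{k^{-1}}=Z^{u}$, where $l_1^{-1}l_2=ku$ with $k\in\mathcal C$, $u\in\mathcal D$. 2. The $\mathcal C$ and $\mathcal D$ conjugates of $\Lambda+\mathfrak l$ give a product structure on $\mathcal U$: the maps $\mathcal C\times(\Lambda+\mathfrak l)\to\mathcal U$, $(k,Y)\mapsto Y^{k^{-1}}$,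 and $\mathcal D\times(\Lambda+\mathfrak l)\to\mathcal U$, $(u,Z)\mapsto Z^{u}$, are real analytic diffeomorphisms; and for all $Y,Z\in\Lambda+\mathfrak l$, $\varphi$ maps $\{Y^{k^{-1}}:k\in\mathcal C\}$ onto $\{Y\}\times(\Lambda+\mathfrak l)$ and $\{Z^{u}:u\in\mathcal D\}$ onto $(\Lambda+\mathfrak l)\times\{Z\}$. -/

import Mathlib

open Set

/- Matrices carry the entrywise supremum norm. Any norm on this finite-dimensional real vector space
gives the same topology and the same real analytic maps. -/
attribute [local instance] Matrix.normedAddCommGroup Matrix.normedSpace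

namespace TodaLU

/-- `n × n` complex matrices. -/
abbrev Mat (n : ℕ) : Type := Matrix (Fin n) (Fin n) ℂ

/-- A real analytic diffeomorphism `f : A → B` with inverse `g : B → A`, where `A` and `B` are subsets
(in applications: embedded submanifolds) of real normed spaces. `AnalyticOn ℝ f A` says that near every
point `x` of `A`, the map `f` agrees on `A` with the sum of a power series converging on a ball of the
ambient space, i.e. that `f` extends locally to a real analytic map of the ambient space. On embedded
real analytic submanifolds this is the intrinsic notion of a real analytic map. -/
structure IsRealAnalyticDiffeo {E F : Type*} [NormedAddCommGroup E] [NormedSpace ℝ E]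
    [NormedAddCommGroup F] [NormedSpace ℝ F] (f : E → F) (g : F → E) (A : Set E) (B : Set F) :
    Prop where
  mapsTo : MapsTo f A B
  mapsTo_inv : MapsTo g B A
  invOn : InvOn g f A B
  analyticOn : AnalyticOn ℝ f A
  analyticOn_inv : AnalyticOn ℝ g B

variable {n : ℕ}

/-- Conjugation `X ^ g = g X g⁻¹`. -/
noncomputable def conj (g X : Mat n) : Mat n := g * X * g⁻¹

/-- The special unitary group `K`. -/
def K (n : ℕ) : Set (Mat n) := {k | k ∈ Matrix.unitaryGroup (Fin n) ℂ ∧ k.det = 1}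

/-- The group `U = AN` of upper triangular matrices of determinant one with positive (real) diagonal
entries. -/
def U (n : ℕ) : Set (Mat n) :=
  {u | (∀ i j, j < i → u i j = 0) ∧ (∀ i, ∃ r : ℝ, 0 < r ∧ u i i = (r : ℂ)) ∧ u.det = 1}

/-- The group `L` of lower triangular matrices with diagonal entries equal to one. -/
def L (n : ℕ) : Set (Mat n) := {l | (∀ i j, i < j → l i j = 0) ∧ ∀ i, l i i = 1}

/-- The special unitary matrices that have an `LU` factorization. -/
def C (n : ℕ) : Set (Mat n) := {k | k ∈ K n ∧ ∃ l ∈ L n, ∃ u ∈ U n, k = l * u}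

/-- The triangular factors `u` in the factorizations `l = k u` of the elements `l` of `L`. -/
def D (n : ℕ) : Set (Mat n) := {u | u ∈ U n ∧ ∃ l ∈ L n, ∃ k ∈ K n, l = k * u}

/-- The affine subspace `Λ + 𝔩`, with `𝔩` the strictly lower triangular matrices. -/
def affineLower (Λ : Mat n) : Set (Mat n) := {Y | ∃ N : Mat n, (∀ i j, i ≤ j → N i j = 0) ∧ Y = Λ + N}

/-- The conjugacy class of `Λ` under the special linear group. -/
def conjClass (Λ : Mat n) : Set (Mat n) :=
  {X | ∃ g : Mat n, g.det = 1 ∧ X = conj g Λ}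

/-- `Φ_C (k, l) = Λ ^ ((l k)⁻¹)`, to be considered on `C × L`. -/
noncomputable def PhiC (Λ : Mat n) (p : Mat n × Mat n) : Mat n := conj (p.2 * p.1)⁻¹ Λ

/-- `Φ_D (u, l) = Λ ^ (u l⁻¹)`, to be considered on `D × L`. -/
noncomputable def PhiD (Λ : Mat n) (p : Mat n × Mat n) : Mat n := conj (p.1 * p.2⁻¹) Λ

/-- The domain `𝒰` of the coordinates: the image of `Φ_C`. -/
def domU (Λ : Mat n) : Set (Mat n) := PhiC Λ '' (C n ×ˢ L n)

/-- The map `φ = (Φ_C ∘ pr₂ ∘ Φ_C⁻¹, Φ_D ∘ pr₂ ∘ Φ_D⁻¹)`, where `L` is identified with `{1} × L`. -/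
noncomputable def phi (Λ X : Mat n) : Mat n × Mat n :=
  (PhiC Λ (1, (Function.invFunOn (PhiC Λ) (C n ×ˢ L n) X).2),
   PhiD Λ (1, (Function.invFunOn (PhiD Λ) (D n ×ˢ L n) X).2))

end TodaLU

namespace TodaLU

open Matrix

variable {n : ℕ}

/-! ### Triangular matrices -/

/-! A point `X` of the conjugacy class is described by a frame: an invertible `g` with `g * X = Λ *
g`, whose rows are left eigenvectors of `X`. The eigenvalues are distinct, so `g` is unique up to
left multiplication by an invertible diagonal matrix `t`. The set `Cell n`, which is `L K ∩ L U`,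
selects one frame out of each torus orbit that contains a matrix with nonzero leading principal
minors. Indeed, the modulus of `t` is fixed by requiring the lower triangular factor in `g = l k` to
have unit diagonal, and its phase by requiring the upper triangular factor in `g = l u` to have
positive diagonal (`normalizer_mul_mem`, `Cell.eq_of_mul_diagonal`). Hence `𝒰` is in bijection with
`Cell n`.

A cell element factors in two ways, `g = l₁ k = l₂ u⁻¹`, which amounts to `l₁⁻¹ l₂ = k u`. By
Gram–Schmidt every element of `L` is such a product, in exactly one way (`L.exists_mul`,
`existsUnique_mul`). So `g` corresponds to an arbitrary pair `(l₁, l₂)`, and `φ` is `X ↦ g ↦ (l₁,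
l₂)`, with `L` identified with `Λ + 𝔩`.

Analyticity comes from explicit formulas. The LU factors are rational in `g`, and Gram–Schmidt is
the LU factorization of `g gᴴ` followed by square roots of positive numbers. A frame near a given
one is obtained from the spectral projections of `X`, which are Lagrange polynomials in `X`
(`eigenframe`). Openness holds because nonvanishing of the minors is an open condition; density
holds because the minors along a segment to the identity have isolated zeros. -/

theorem mul_inv_of_isUnit {g : Mat n} (h : IsUnit g) : g * g⁻¹ = 1 :=
  Matrix.mul_nonsing_inv g ((Matrix.isUnit_iff_isUnit_det g).1 h)

theorem inv_mul_of_isUnit {g : Mat n} (h : IsUnit g) : g⁻¹ * g = 1 :=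
  Matrix.nonsing_inv_mul g ((Matrix.isUnit_iff_isUnit_det g).1 h)

theorem isUnit_of_mul_eq_one {a b : Mat n} (h : a * b = 1) : IsUnit a :=
  ⟨⟨a, b, h, mul_eq_one_comm.1 h⟩, rfl⟩

theorem isUnit_of_det_eq_one {g : Mat n} (h : g.det = 1) : IsUnit g := by
  rw [Matrix.isUnit_iff_isUnit_det, h]; exact isUnit_one

theorem isUnit_inv {g : Mat n} (h : IsUnit g) : IsUnit g⁻¹ :=
  isUnit_of_mul_eq_one (inv_mul_of_isUnit h)

theorem IsUpper.inv {g : Mat n} (hg : g.IsUpperTriangular) (h : IsUnit g) :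
    (g⁻¹).IsUpperTriangular := by
  let _ := h.invertible
  exact Matrix.blockTriangular_inv_of_blockTriangular hg

theorem IsLower.inv {g : Mat n} (hg : g.IsLowerTriangular) (h : IsUnit g) :
    (g⁻¹).IsLowerTriangular := by
  let _ := h.invertible
  exact Matrix.blockTriangular_inv_of_blockTriangular hg

theorem IsUpper.mul_diag {a b : Mat n} (ha : a.IsUpperTriangular) (hb : b.IsUpperTriangular)
    (i : Fin n) : (a * b) i i = a i i * b i i := by
  rw [Matrix.mul_apply]
  refine Finset.sum_eq_single i (fun j _ hj => ?_) (by simp)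
  rcases lt_or_gt_of_ne hj with h | h
  · rw [show a i j = 0 from ha h, zero_mul]
  · rw [show b j i = 0 from hb h, mul_zero]

theorem IsLower.mul_diag {a b : Mat n} (ha : a.IsLowerTriangular) (hb : b.IsLowerTriangular)
    (i : Fin n) : (a * b) i i = a i i * b i i := by
  rw [Matrix.mul_apply]
  refine Finset.sum_eq_single i (fun j _ hj => ?_) (by simp)
  rcases lt_or_gt_of_ne hj with h | h
  · rw [show b j i = 0 from hb h, mul_zero]
  · rw [show a i j = 0 from ha h, zero_mul]

theorem isUpper_conjTranspose {g : Mat n} (hg : g.IsLowerTriangular) : gᴴ.IsUpperTriangular := by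
  intro i j hij
  rw [Matrix.conjTranspose_apply, show g j i = 0 from hg hij, star_zero]

theorem isLower_conjTranspose {g : Mat n} (hg : g.IsUpperTriangular) : gᴴ.IsLowerTriangular := by
  intro i j hij
  rw [Matrix.conjTranspose_apply, show g j i = 0 from hg hij, star_zero]

theorem eq_diagonal_of_isLower_of_isUpper {g : Mat n} (hl : g.IsLowerTriangular)
    (hu : g.IsUpperTriangular) : g = diagonal fun i => g i i := by
  ext i j
  rcases lt_trichotomy i j with h | rfl | h
  · rw [diagonal_apply_ne _ h.ne]; exact hl h
  · simp
  · rw [diagonal_apply_ne _ h.ne']; exact hu h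

theorem isUnit_diagonal {t : Fin n → ℂ} (h : ∀ i, t i ≠ 0) : IsUnit (diagonal t : Mat n) := by
  refine isUnit_of_mul_eq_one (b := diagonal fun i => (t i)⁻¹) ?_
  rw [diagonal_mul_diagonal, ← diagonal_one]
  congr 1; ext i; exact mul_inv_cancel₀ (h i)

theorem isLower_diagonal (t : Fin n → ℂ) : (diagonal t : Mat n).IsLowerTriangular :=
  blockTriangular_diagonal t

theorem isUpper_diagonal (t : Fin n → ℂ) : (diagonal t : Mat n).IsUpperTriangular :=
  blockTriangular_diagonal t

/-! ### The groups `L` and `U` -/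

theorem L.isLower {l : Mat n} (h : l ∈ L n) : l.IsLowerTriangular := fun i j hij => h.1 i j hij

theorem L.det {l : Mat n} (h : l ∈ L n) : l.det = 1 := by
  rw [det_of_isLowerTriangular l (L.isLower h)]
  exact Finset.prod_eq_one fun i _ => h.2 i

theorem L.isUnit {l : Mat n} (h : l ∈ L n) : IsUnit l := isUnit_of_det_eq_one (L.det h)

theorem L.one : (1 : Mat n) ∈ L n := ⟨fun _ _ h => one_apply_ne h.ne, fun _ => one_apply_eq _⟩

theorem L.mul {a b : Mat n} (ha : a ∈ L n) (hb : b ∈ L n) : a * b ∈ L n :=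
  ⟨fun _ _ h => ((L.isLower ha).mul (L.isLower hb)) h, fun i => by
    rw [IsLower.mul_diag (L.isLower ha) (L.isLower hb), ha.2, hb.2, one_mul]⟩

theorem L.inv {a : Mat n} (ha : a ∈ L n) : a⁻¹ ∈ L n := by
  have hl := IsLower.inv (L.isLower ha) (L.isUnit ha)
  refine ⟨fun _ _ h => hl h, fun i => ?_⟩
  have := IsLower.mul_diag hl (L.isLower ha) i
  rw [inv_mul_of_isUnit (L.isUnit ha), ha.2] at this
  simpa using this.symm

theorem L.diagonal_conj {a : Mat n} (ha : a ∈ L n) {t s : Fin n → ℂ} (h : ∀ i, t i * s i = 1) :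
    diagonal t * a * diagonal s ∈ L n := by
  refine ⟨fun i j hij => ?_, fun i => ?_⟩
  · simp [ha.1 i j hij]
  · simp [ha.2 i, h i]

theorem U.isUpper {u : Mat n} (h : u ∈ U n) : u.IsUpperTriangular := fun i j hij => h.1 i j hij

theorem U.isUnit {u : Mat n} (h : u ∈ U n) : IsUnit u := isUnit_of_det_eq_one h.2.2

theorem U.one : (1 : Mat n) ∈ U n :=
  ⟨fun _ _ h => one_apply_ne h.ne', fun _ => ⟨1, one_pos, by simp⟩, det_one⟩

theorem U.inv {u : Mat n} (h : u ∈ U n) : u⁻¹ ∈ U n := by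
  have hu := IsUpper.inv (U.isUpper h) (U.isUnit h)
  refine ⟨fun _ _ hij => hu hij, fun i => ?_, ?_⟩
  · obtain ⟨r, hr, hri⟩ := h.2.1 i
    have := IsUpper.mul_diag hu (U.isUpper h) i
    rw [inv_mul_of_isUnit (U.isUnit h), hri, one_apply_eq] at this
    exact ⟨r⁻¹, inv_pos.2 hr, by push_cast; exact (eq_inv_of_mul_eq_one_left this.symm)⟩
  · rw [det_nonsing_inv, h.2.2, Ring.inverse_one]

/-! ### The LU factorization -/

/-- The coordinate projection onto the span of the first `i` basis vectors. -/
def ini (i : Fin n) : Mat n := diagonal fun j => if j < i then 1 else 0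

theorem ini_mul_ini (i : Fin n) : ini i * ini i = ini i := by
  rw [ini, diagonal_mul_diagonal]; congr 1; ext j; simp

theorem ini_mul_compl (i : Fin n) : ini i * (1 - ini i) = 0 := by
  rw [mul_sub, ini_mul_ini, mul_one, sub_self]

theorem compl_mul_ini (i : Fin n) : (1 - ini i) * ini i = 0 := by
  rw [sub_mul, ini_mul_ini, one_mul, sub_self]

theorem compl_mul_compl (i : Fin n) : (1 - ini i) * (1 - ini i) = 1 - ini i := by
  rw [mul_sub, compl_mul_ini, mul_one, sub_zero]

/-- The leading principal block of size `i`, completed by an identity block. -/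
def pad (i : Fin n) (g : Mat n) : Mat n := ini i * g * ini i + (1 - ini i)

theorem pad_one (i : Fin n) : pad i (1 : Mat n) = 1 := by
  rw [pad, mul_one, ini_mul_ini, add_sub_cancel]

theorem pad_mul_ini (i : Fin n) (g : Mat n) : pad i g * ini i = ini i * g * ini i := by
  rw [pad, add_mul, compl_mul_ini, mul_assoc, ini_mul_ini, add_zero]

theorem pad_mul_compl (i : Fin n) (g : Mat n) : pad i g * (1 - ini i) = 1 - ini i := by
  rw [pad, add_mul, compl_mul_compl, mul_assoc, ini_mul_compl, mul_zero, zero_add]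

theorem ini_mul_of_isLower {l : Mat n} (hl : l.IsLowerTriangular) (i : Fin n) :
    ini i * l * ini i = ini i * l := by
  ext a b
  simp only [ini, mul_diagonal, diagonal_mul]
  by_cases ha : a < i <;> by_cases hb : b < i <;> simp [ha, hb]
  exact (hl (show a < b from lt_of_lt_of_le ha (not_lt.1 hb))).symm

theorem mul_ini_of_isUpper {u : Mat n} (hu : u.IsUpperTriangular) (i : Fin n) :
    ini i * u * ini i = u * ini i := by
  ext a b
  simp only [ini, mul_diagonal, diagonal_mul]
  by_cases ha : a < i <;> by_cases hb : b < i <;> simp [ha, hb]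
  exact (hu (lt_of_lt_of_le hb (not_lt.1 ha))).symm

theorem pad_mul_pad (i : Fin n) (a b : Mat n) :
    pad i a * pad i b = ini i * a * ini i * b * ini i + (1 - ini i) := by
  rw [pad, pad, add_mul, mul_add, mul_add, mul_assoc _ (ini i) (1 - ini i), ini_mul_compl,
    mul_zero, add_zero, compl_mul_compl]
  simp only [← mul_assoc]
  rw [compl_mul_ini, mul_assoc (ini i * a), ini_mul_ini]
  simp

/-- The first rows of a lower triangular matrix vanish beyond the block, so leading blocks multiply.
Padding by an identity keeps blocks of all sizes in one matrix ring, where invertibility can be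
stated uniformly. -/
theorem pad_mul_of_isLower {l : Mat n} (hl : l.IsLowerTriangular) (i : Fin n) (g : Mat n) :
    pad i (l * g) = pad i l * pad i g := by
  rw [pad_mul_pad, ini_mul_of_isLower hl, pad, ← mul_assoc (ini i)]

theorem pad_mul_of_isUpper {u : Mat n} (hu : u.IsUpperTriangular) (i : Fin n) (g : Mat n) :
    pad i (g * u) = pad i g * pad i u := by
  have h := mul_ini_of_isUpper hu i
  rw [pad_mul_pad, mul_assoc (ini i * g), mul_assoc (ini i * g), h, pad]
  simp only [mul_assoc]

/-- A matrix that is invertible and has invertible leading principal blocks. -/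
def Regular (g : Mat n) : Prop := IsUnit g ∧ ∀ i, IsUnit (pad i g)

theorem Regular.lower {l : Mat n} (hl : l.IsLowerTriangular) (h : IsUnit l) : Regular l :=
  ⟨h, fun i => isUnit_of_mul_eq_one (b := pad i l⁻¹) (by
    rw [← pad_mul_of_isLower hl, mul_inv_of_isUnit h, pad_one])⟩

theorem Regular.upper {u : Mat n} (hu : u.IsUpperTriangular) (h : IsUnit u) : Regular u :=
  ⟨h, fun i => isUnit_of_mul_eq_one (b := pad i u⁻¹) (by
    rw [← pad_mul_of_isUpper (IsUpper.inv hu h), mul_inv_of_isUnit h, pad_one])⟩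

theorem Regular.lower_mul {l g : Mat n} (hl : l.IsLowerTriangular) (h : IsUnit l)
    (hg : Regular g) : Regular (l * g) :=
  ⟨h.mul hg.1, fun i => by
    rw [pad_mul_of_isLower hl]; exact ((Regular.lower hl h).2 i).mul (hg.2 i)⟩

/-- The inverse of the unit lower triangular factor in the LU factorization. -/
noncomputable def lowInv (g : Mat n) : Mat n :=
  1 - Matrix.of fun i j => (g * ini i * (pad i g)⁻¹) i j

/-- The unit lower triangular factor in the LU factorization. -/
noncomputable def low (g : Mat n) : Mat n := (lowInv g)⁻¹

/-- The upper triangular factor in the LU factorization. -/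
noncomputable def up (g : Mat n) : Mat n := lowInv g * g

theorem pad_inv_mul_compl {g : Mat n} {i : Fin n} (h : IsUnit (pad i g)) :
    (pad i g)⁻¹ * (1 - ini i) = 1 - ini i := by
  conv_lhs => rw [← pad_mul_compl i g, ← mul_assoc, inv_mul_of_isUnit h, one_mul]

theorem mul_pad_inv_mul_compl {g : Mat n} {i : Fin n} (h : IsUnit (pad i g)) :
    g * ini i * (pad i g)⁻¹ * (1 - ini i) = 0 := by
  rw [mul_assoc, pad_inv_mul_compl h, mul_assoc, ini_mul_compl, mul_zero]

/-- Row `i` of `g * ini i * (pad i g)⁻¹` holds the coefficients of the combination of rows before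
`i` that matches row `i` of `g` in its first entries. It is therefore supported strictly below the
diagonal. -/
theorem lowInv_mem {g : Mat n} (hg : Regular g) : lowInv g ∈ L n := by
  have key : ∀ i j, i ≤ j → (g * ini i * (pad i g)⁻¹) i j = 0 := by
    intro i j hij
    have := congrFun (congrFun (mul_pad_inv_mul_compl (hg.2 i)) i) j
    rw [mul_sub, mul_one] at this
    simpa [ini, not_lt.2 hij] using this
  refine ⟨fun i j hij => ?_, fun i => ?_⟩
  · simp [lowInv, key i j hij.le, one_apply_ne hij.ne]
  · simp [lowInv, key i i le_rfl]

/-- Gaussian elimination: the combination of earlier rows subtracted from row `i` agrees with that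
row in all columns before `i`. -/
theorem up_isUpper {g : Mat n} (hg : Regular g) : (up g).IsUpperTriangular := by
  intro i j hij
  have hij : j < i := hij
  -- With `A = g * ini i * (pad i g)⁻¹` one has `A = A * ini i`, so only the leading block of `g`
  -- enters `A * g * ini i`, and it cancels against the inverse.
  have h1 : g * ini i * (pad i g)⁻¹ * g * ini i = g * ini i := by
    have h0 := mul_pad_inv_mul_compl (hg.2 i)
    rw [mul_sub, mul_one, sub_eq_zero] at h0
    conv_lhs => rw [h0]
    rw [mul_assoc, mul_assoc, ← mul_assoc (ini i) g, ← pad_mul_ini, mul_assoc, ← mul_assoc _ (pad i g),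
      inv_mul_of_isUnit (hg.2 i), one_mul, mul_assoc, ini_mul_ini]
  have h2 := congrFun (congrFun h1 i) j
  simp only [ini, mul_diagonal, hij, if_true, mul_one] at h2
  have h3 : ((Matrix.of fun i j => (g * ini i * (pad i g)⁻¹) i j : Mat n) * g) i j =
      (g * ini i * (pad i g)⁻¹ * g) i j := by
    simp only [Matrix.mul_apply, Matrix.of_apply]
  rw [up, lowInv, sub_mul, one_mul, Matrix.sub_apply, h3]
  simp only [ini]
  rw [h2, sub_self]

theorem low_mem {g : Mat n} (hg : Regular g) : low g ∈ L n := L.inv (lowInv_mem hg)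

theorem low_mul_up {g : Mat n} (hg : Regular g) : low g * up g = g := by
  rw [low, up, ← mul_assoc, inv_mul_of_isUnit (L.isUnit (lowInv_mem hg)), one_mul]

theorem up_isUnit {g : Mat n} (hg : Regular g) : IsUnit (up g) := (L.isUnit (lowInv_mem hg)).mul hg.1

/-- The quotient `l'⁻¹ * l = u' * u⁻¹` is both unit lower triangular and upper triangular, hence the
identity. -/
theorem lu_unique {l l' u u' : Mat n} (hl : l ∈ L n) (hl' : l' ∈ L n) (hu : u.IsUpperTriangular)
    (hu' : u'.IsUpperTriangular) (h : IsUnit u) (e : l * u = l' * u') : l = l' ∧ u = u' := by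
  have e1 : l'⁻¹ * l = u' * u⁻¹ := by
    calc l'⁻¹ * l = l'⁻¹ * (l * u) * u⁻¹ := by
          rw [mul_assoc, mul_assoc, mul_inv_of_isUnit h, mul_one]
      _ = u' * u⁻¹ := by rw [e, ← mul_assoc l'⁻¹, inv_mul_of_isUnit (L.isUnit hl'), one_mul]
  have hm := L.mul (L.inv hl') hl
  have hup : (l'⁻¹ * l).IsUpperTriangular := e1 ▸ hu'.mul (IsUpper.inv hu h)
  have e2 : l'⁻¹ * l = 1 := by
    rw [eq_diagonal_of_isLower_of_isUpper (L.isLower hm) hup, ← diagonal_one]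
    congr 1; ext i; exact hm.2 i
  have e3 : l = l' := by
    rw [← one_mul l, ← mul_inv_of_isUnit (L.isUnit hl'), mul_assoc, e2, mul_one]
  refine ⟨e3, ?_⟩
  subst e3
  rw [← one_mul u, ← inv_mul_of_isUnit (L.isUnit hl), mul_assoc, e, ← mul_assoc,
    inv_mul_of_isUnit (L.isUnit hl), one_mul]

theorem Regular.of_lu {l u : Mat n} (hl : l ∈ L n) (hu : u.IsUpperTriangular) (h : IsUnit u) :
    Regular (l * u) := Regular.lower_mul (L.isLower hl) (L.isUnit hl) (Regular.upper hu h)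

theorem low_up_eq {l u : Mat n} (hl : l ∈ L n) (hu : u.IsUpperTriangular) (h : IsUnit u) :
    low (l * u) = l ∧ up (l * u) = u := by
  have hr := Regular.of_lu hl hu h
  exact lu_unique (low_mem hr) hl (up_isUpper hr) hu (up_isUnit hr) (low_mul_up hr)

/-! ### The Gram–Schmidt factorization -/

theorem eq_zero_of_mul_conjTranspose {a : Mat n} {i : Fin n} (h : (a * aᴴ) i i = 0) (j : Fin n) :
    a i j = 0 := by
  have h1 : ∑ j, Complex.normSq (a i j) = 0 := by
    have : ((∑ j, Complex.normSq (a i j) : ℝ) : ℂ) = 0 := by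
      rw [← h, Matrix.mul_apply]; push_cast
      exact Finset.sum_congr rfl fun j _ => by
        rw [conjTranspose_apply]; exact (Complex.mul_conj _).symm
    exact_mod_cast this
  rw [Finset.sum_eq_zero_iff_of_nonneg fun j _ => Complex.normSq_nonneg _] at h1
  exact Complex.normSq_eq_zero.1 (h1 j (Finset.mem_univ j))

theorem isUnit_conjTranspose {g : Mat n} (h : IsUnit g) : IsUnit gᴴ :=
  isUnit_of_mul_eq_one (b := (g⁻¹)ᴴ) (by
    rw [← conjTranspose_mul, inv_mul_of_isUnit h, conjTranspose_one])

/-- The row lengths in Gram–Schmidt: the square roots of the diagonal entries of `a aᴴ`. -/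
noncomputable def rowNorm (a : Mat n) (i : Fin n) : ℂ := ((Real.sqrt ((a * aᴴ) i i).re : ℝ) : ℂ)

theorem mul_conjTranspose_diag (a : Mat n) (i : Fin n) :
    (a * aᴴ) i i = ((∑ j, Complex.normSq (a i j) : ℝ) : ℂ) := by
  rw [Matrix.mul_apply]; push_cast
  exact Finset.sum_congr rfl fun j _ => by rw [conjTranspose_apply]; exact Complex.mul_conj _

theorem mul_conjTranspose_diag_pos {a : Mat n} (ha : IsUnit a) (i : Fin n) :
    0 < ((a * aᴴ) i i).re := by
  rw [mul_conjTranspose_diag, Complex.ofReal_re]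
  refine lt_of_le_of_ne (Finset.sum_nonneg fun j _ => Complex.normSq_nonneg _) fun h => ?_
  have h0 : (a * aᴴ) i i = 0 := by rw [mul_conjTranspose_diag, ← h, Complex.ofReal_zero]
  have := congrFun (congrFun (mul_inv_of_isUnit ha) i) i
  rw [Matrix.mul_apply, one_apply_eq] at this
  simp [eq_zero_of_mul_conjTranspose h0] at this

theorem rowNorm_pos {a : Mat n} (ha : IsUnit a) (i : Fin n) :
    ∃ r : ℝ, 0 < r ∧ rowNorm a i = r :=
  ⟨_, Real.sqrt_pos.2 (mul_conjTranspose_diag_pos ha i), rfl⟩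

theorem rowNorm_mul_self (a : Mat n) (i : Fin n) :
    rowNorm a i * rowNorm a i = (a * aᴴ) i i := by
  rw [rowNorm, mul_conjTranspose_diag, ← Complex.ofReal_mul, Complex.ofReal_re,
    Real.mul_self_sqrt (Finset.sum_nonneg fun j _ => Complex.normSq_nonneg _)]

open scoped ComplexOrder in
-- Positive definiteness passes to leading blocks: a kernel vector `x` of the padded block is
-- supported on the block, so `xᴴ g gᴴ x = 0`, which forces `gᴴ x = 0` and then `x = 0`.
theorem Regular.gram {g : Mat n} (hg : IsUnit g) : Regular (g * gᴴ) := by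
  refine ⟨hg.mul (isUnit_conjTranspose hg), fun i => ?_⟩
  rw [← Matrix.mulVec_injective_iff_isUnit]
  refine (injective_iff_map_eq_zero (pad i (g * gᴴ)).mulVecLin).2 fun x hx => ?_
  rw [Matrix.mulVecLin_apply] at hx
  have h1 : (1 - ini i) * pad i (g * gᴴ) = 1 - ini i := by
    rw [pad, mul_add, ← mul_assoc, ← mul_assoc, compl_mul_ini, compl_mul_compl]
    simp
  have h2 : (1 - ini i) *ᵥ x = 0 := by
    rw [← h1, ← Matrix.mulVec_mulVec, hx, Matrix.mulVec_zero]
  have h3 : ini i *ᵥ x = x := by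
    rw [Matrix.sub_mulVec, Matrix.one_mulVec, sub_eq_zero] at h2
    exact h2.symm
  have h4 : ini i *ᵥ ((g * gᴴ) *ᵥ x) = 0 := by
    rw [pad, Matrix.add_mulVec, h2, add_zero, ← Matrix.mulVec_mulVec, h3,
      ← Matrix.mulVec_mulVec] at hx
    exact hx
  have h5 : star x ⬝ᵥ ((g * gᴴ) *ᵥ x) = 0 := by
    have hH : (ini i)ᴴ = ini i := by
      rw [ini, diagonal_conjTranspose]; congr 1; ext j; simp [apply_ite]
    conv_lhs => rw [← h3, Matrix.star_mulVec, ← Matrix.dotProduct_mulVec, h3, hH, h4]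
    simp
  have h6 : gᴴ *ᵥ x = 0 := by
    rw [← Matrix.mulVec_mulVec, Matrix.dotProduct_mulVec, ← conjTranspose_conjTranspose g,
      ← Matrix.star_mulVec, conjTranspose_conjTranspose] at h5
    exact dotProduct_star_self_eq_zero.1 h5
  rw [← Matrix.one_mulVec x, ← inv_mul_of_isUnit (isUnit_conjTranspose hg), ← Matrix.mulVec_mulVec,
    h6, Matrix.mulVec_zero]

/-- The lengths of the vectors in the Gram–Schmidt orthogonalization of the rows of `g`. -/
noncomputable def gramDiag (g : Mat n) : Fin n → ℂ := rowNorm (lowInv (g * gᴴ) * g)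

/-- The lower triangular factor with positive diagonal in the Gram–Schmidt factorization. -/
noncomputable def gramLow (g : Mat n) : Mat n := low (g * gᴴ) * diagonal (gramDiag g)

theorem gramDiag_pos {g : Mat n} (hg : IsUnit g) (i : Fin n) :
    ∃ r : ℝ, 0 < r ∧ gramDiag g i = r :=
  rowNorm_pos ((L.isUnit (lowInv_mem (Regular.gram hg))).mul hg) i

theorem gramDiag_ne_zero {g : Mat n} (hg : IsUnit g) (i : Fin n) : gramDiag g i ≠ 0 := by
  obtain ⟨r, hr, h⟩ := gramDiag_pos hg i
  rw [h]; exact_mod_cast hr.ne'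

/-- Removing the unit lower factor of `g gᴴ` from `g` leaves a matrix `a` with orthogonal rows: `a
aᴴ` is upper triangular and Hermitian, hence diagonal. Dividing its rows by their lengths gives the
unitary factor. -/
theorem gramLow_spec {g : Mat n} (hg : IsUnit g) :
    ∃ q ∈ unitaryGroup (Fin n) ℂ, g = gramLow g * q := by
  set H := g * gᴴ with hH
  have hR := Regular.gram hg
  set a := lowInv H * g with ha
  have hli := lowInv_mem hR
  have hau : IsUnit a := (L.isUnit hli).mul hg
  have e1 : a * aᴴ = up H * (lowInv H)ᴴ := by
    rw [ha, conjTranspose_mul, up, hH]; simp only [mul_assoc]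
  have hupper : (a * aᴴ).IsUpperTriangular :=
    e1 ▸ (up_isUpper hR).mul (isUpper_conjTranspose (L.isLower hli))
  have hlower : (a * aᴴ).IsLowerTriangular := by
    have := isLower_conjTranspose hupper
    rwa [conjTranspose_mul, conjTranspose_conjTranspose] at this
  have e2 : a * aᴴ = diagonal (gramDiag g) * diagonal (gramDiag g) := by
    rw [eq_diagonal_of_isLower_of_isUpper hlower hupper, diagonal_mul_diagonal]
    congr 1; ext i; exact (rowNorm_mul_self a i).symm
  have hδ := isUnit_diagonal (gramDiag_ne_zero hg)
  have hstar : (diagonal (gramDiag g) : Mat n)ᴴ = diagonal (gramDiag g) := by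
    rw [diagonal_conjTranspose]; congr 1; ext i
    obtain ⟨r, -, h⟩ := gramDiag_pos hg i
    rw [Pi.star_apply, h]; exact Complex.conj_ofReal r
  refine ⟨(diagonal (gramDiag g))⁻¹ * a, ?_, ?_⟩
  · rw [mem_unitaryGroup_iff, star_eq_conjTranspose, conjTranspose_mul, conjTranspose_nonsing_inv,
      hstar]
    set δ : Mat n := diagonal (gramDiag g)
    calc δ⁻¹ * a * (aᴴ * δ⁻¹) = δ⁻¹ * (a * aᴴ) * δ⁻¹ := by simp only [mul_assoc]
      _ = (δ⁻¹ * δ) * (δ * δ⁻¹) := by rw [e2]; simp only [mul_assoc]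
      _ = 1 := by rw [inv_mul_of_isUnit hδ, mul_inv_of_isUnit hδ, one_mul]
  · rw [gramLow, mul_assoc, ← mul_assoc (Matrix.diagonal _), mul_inv_of_isUnit hδ, one_mul, ha, ← mul_assoc,
      low, inv_mul_of_isUnit (L.isUnit hli), one_mul]

/-- Lower triangular with positive diagonal. -/
def PosLower (b : Mat n) : Prop :=
  b.IsLowerTriangular ∧ ∀ i, ∃ r : ℝ, 0 < r ∧ b i i = r

theorem PosLower.ne_zero {b : Mat n} (hb : PosLower b) (i : Fin n) : b i i ≠ 0 := by
  obtain ⟨r, hr, h⟩ := hb.2 i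
  rw [h]; exact_mod_cast hr.ne'

theorem L.posLower {l : Mat n} (h : l ∈ L n) : PosLower l :=
  ⟨(L.isLower h), fun i => ⟨1, one_pos, by rw [h.2 i, Complex.ofReal_one]⟩⟩

/-- Uniqueness in Gram–Schmidt. The unitary factor drops out of the Gram matrix, which becomes `b bᴴ
= l (β² lᴴ)` with `β` the diagonal of `b`. Uniqueness of LU recovers `l`, and positivity recovers
`β` from its square. -/
theorem gramLow_eq {b q : Mat n} (hb : PosLower b) (hq : q ∈ unitaryGroup (Fin n) ℂ) :
    gramLow (b * q) = b := by
  set β : Fin n → ℂ := fun i => b i i with hβ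
  have hbi : ∀ i, (β i)⁻¹ * β i = 1 := fun i => inv_mul_cancel₀ (hb.ne_zero i)
  have hβu : IsUnit (diagonal β : Mat n) := isUnit_diagonal hb.ne_zero
  set l : Mat n := b * Matrix.diagonal fun i => (β i)⁻¹ with hl
  have hlL : l ∈ L n := by
    refine ⟨fun i j hij => ?_, fun i => ?_⟩
    · simp [hl, show b i j = 0 from hb.1 hij]
    · simp [hl, hβ, mul_inv_cancel₀ (hb.ne_zero i)]
  have hbl : b = l * diagonal β := by
    rw [hl, mul_assoc, diagonal_mul_diagonal]; simp [hbi]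
  have hqq : q * qᴴ = 1 := mem_unitaryGroup_iff.1 hq
  have hstar : (diagonal β : Mat n)ᴴ = diagonal β := by
    rw [diagonal_conjTranspose]; congr 1; ext i
    obtain ⟨r, -, h⟩ := hb.2 i
    rw [Pi.star_apply, hβ]; simp only; rw [h]; exact Complex.conj_ofReal r
  have e1 : b * q * (b * q)ᴴ = l * (diagonal β * diagonal β * lᴴ) := by
    rw [conjTranspose_mul, mul_assoc, ← mul_assoc q, hqq, one_mul, hbl, conjTranspose_mul, hstar]
    simp only [mul_assoc]
  have hlow : low (b * q * (b * q)ᴴ) = l := by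
    rw [e1]
    exact (low_up_eq hlL (((isUpper_diagonal β).mul (isUpper_diagonal β)).mul
      (isUpper_conjTranspose (L.isLower hlL)))
      ((hβu.mul hβu).mul (isUnit_conjTranspose (L.isUnit hlL)))).1
  have hli : lowInv (b * q * (b * q)ᴴ) = l⁻¹ := by
    have hR := Regular.gram ((hbl ▸ (L.isUnit hlL).mul hβu : IsUnit b).mul (isUnit_of_mul_eq_one hqq))
    rw [← hlow, low, nonsing_inv_nonsing_inv _ ((isUnit_iff_isUnit_det _).1 (L.isUnit (lowInv_mem hR)))]
  have hd : gramDiag (b * q) = β := by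
    funext i
    have e2 : lowInv (b * q * (b * q)ᴴ) * (b * q) = diagonal β * q := by
      rw [hli, hbl, mul_assoc, ← mul_assoc l⁻¹, inv_mul_of_isUnit (L.isUnit hlL), one_mul]
    obtain ⟨r, hr, h⟩ := hb.2 i
    rw [gramDiag, e2, rowNorm, conjTranspose_mul, mul_assoc, ← mul_assoc q, hqq, one_mul, hstar,
      diagonal_mul_diagonal, diagonal_apply_eq, hβ]
    simp only
    rw [h, ← Complex.ofReal_mul, Complex.ofReal_re, Real.sqrt_mul_self hr.le]
  rw [gramLow, hlow, hd, ← hbl]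

end TodaLU

namespace TodaLU

open Matrix

variable {n : ℕ}

/-! ### The factorizations `L K` and `L U` -/

theorem eq_one_of_mul_eq_one_of_pos {z : ℂ} (hz : z ∈ unitary ℂ) {r : ℝ} (hr : 0 < r)
    (h : z = r) : z = 1 := by
  have h1 : star z * z = 1 := (Unitary.mem_iff.1 hz).1
  rw [h] at h1 ⊢
  have h2 : r * r = 1 := by
    have : (r : ℂ) * r = 1 := by simpa using h1
    exact_mod_cast this
  have : r = 1 := by nlinarith
  rw [this, Complex.ofReal_one]

theorem exists_det_eq_of_diag_pos {u : Mat n} (hu : u.det = ∏ i, u i i)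
    (h : ∀ i, ∃ r : ℝ, 0 < r ∧ u i i = r) : ∃ r : ℝ, 0 < r ∧ u.det = r := by
  choose r hr h using h
  exact ⟨∏ i, r i, Finset.prod_pos fun i _ => hr i, by simp [hu, h]⟩

theorem K.isUnit {k : Mat n} (h : k ∈ K n) : IsUnit k := isUnit_of_det_eq_one h.2

theorem C.isUnit {k : Mat n} (h : k ∈ C n) : IsUnit k := K.isUnit h.1

theorem D.isUnit {u : Mat n} (h : u ∈ D n) : IsUnit u := U.isUnit h.1

theorem C.one : (1 : Mat n) ∈ C n :=
  ⟨⟨one_mem _, det_one⟩, 1, L.one, 1, U.one, (one_mul 1).symm⟩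

theorem gramLow_posLower {g : Mat n} (hg : IsUnit g) : PosLower (gramLow g) := by
  have hl := low_mem (Regular.gram hg)
  refine ⟨(L.isLower hl).mul (isLower_diagonal _), fun i => ?_⟩
  obtain ⟨r, hr, h⟩ := gramDiag_pos hg i
  exact ⟨r, hr, by rw [gramLow, mul_diagonal, hl.2, one_mul, h]⟩

/-- The set of products `l k` with `l ∈ L` and `k ∈ C`. -/
def Cell (n : ℕ) : Set (Mat n) := {g | ∃ l ∈ L n, ∃ k ∈ C n, g = l * k}

theorem Cell.isUnit {g : Mat n} (h : g ∈ Cell n) : IsUnit g := by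
  obtain ⟨l, hl, k, hk, rfl⟩ := h
  exact (L.isUnit hl).mul (C.isUnit hk)

theorem Cell.det {g : Mat n} (h : g ∈ Cell n) : g.det = 1 := by
  obtain ⟨l, hl, k, hk, rfl⟩ := h
  rw [det_mul, L.det hl, hk.1.2, one_mul]

/-- If `k = l₁ u`, then `l k = (l l₁) u`, and `l₁ = k u⁻¹` shows `u⁻¹ ∈ D`. Together with
`Cell.of_lu` this is why `Φ_C` and `Φ_D` have the same image. -/
theorem Cell.exists_lu {g : Mat n} (h : g ∈ Cell n) : ∃ l ∈ L n, ∃ u ∈ D n, g = l * u⁻¹ := by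
  obtain ⟨l, hl, k, ⟨hk, l₁, hl₁, u, hu, rfl⟩, rfl⟩ := h
  have huu := mul_inv_of_isUnit (U.isUnit hu)
  refine ⟨l * l₁, L.mul hl hl₁, u⁻¹, ⟨U.inv hu, l₁, hl₁, l₁ * u, hk, ?_⟩, ?_⟩
  · rw [mul_assoc, huu, mul_one]
  · rw [nonsing_inv_nonsing_inv _ ((isUnit_iff_isUnit_det _).1 (U.isUnit hu)), mul_assoc]

theorem Cell.of_lu {l u : Mat n} (hl : l ∈ L n) (hu : u ∈ D n) : l * u⁻¹ ∈ Cell n := by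
  obtain ⟨huU, l₂, hl₂, k, hk, e⟩ := hu
  have huu := mul_inv_of_isUnit (U.isUnit huU)
  have e' : k = l₂ * u⁻¹ := by rw [e, mul_assoc, huu, mul_one]
  refine ⟨l * l₂⁻¹, L.mul hl (L.inv hl₂), k, ⟨hk, l₂, hl₂, u⁻¹, U.inv huU, e'⟩, ?_⟩
  rw [e', mul_assoc, ← mul_assoc l₂⁻¹, inv_mul_of_isUnit (L.isUnit hl₂), one_mul]

theorem Cell.regular {g : Mat n} (h : g ∈ Cell n) : Regular g := by
  obtain ⟨l, hl, u, hu, rfl⟩ := Cell.exists_lu h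
  exact Regular.of_lu hl (U.isUpper (U.inv hu.1)) (isUnit_inv (D.isUnit hu))

theorem low_mul_inv {l u : Mat n} (hl : l ∈ L n) (hu : u ∈ D n) : low (l * u⁻¹) = l :=
  (low_up_eq hl (U.isUpper (U.inv hu.1)) (isUnit_inv (D.isUnit hu))).1

theorem gramLow_mul {l k : Mat n} (hl : l ∈ L n) (hk : k ∈ C n) : gramLow (l * k) = l :=
  gramLow_eq (L.posLower hl) hk.1.1

theorem mul_left_cancel_of_isUnit {a b c : Mat n} (ha : IsUnit a) (h : a * b = a * c) : b = c := by
  rw [← one_mul b, ← inv_mul_of_isUnit ha, mul_assoc, h, ← mul_assoc, inv_mul_of_isUnit ha, one_mul]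

/-- A torus orbit meets the cell at most once. Comparing LU factorizations shows that `t` is
positive; then `t l` is an admissible Gram–Schmidt factor, and comparing it with the unipotent `l'`
gives `t = 1`. -/
theorem Cell.eq_of_mul_diagonal {g g' : Mat n} (hg : g ∈ Cell n) (hg' : g' ∈ Cell n)
    {t : Fin n → ℂ} (ht : ∀ i, t i ≠ 0) (e : g' = diagonal t * g) : g' = g := by
  have htt : ∀ i, t i * (t i)⁻¹ = 1 := fun i => mul_inv_cancel₀ (ht i)
  have hpos : ∀ i, ∃ r : ℝ, 0 < r ∧ t i = r := by
    obtain ⟨l, hl, u, hu, h⟩ := Cell.exists_lu hg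
    obtain ⟨l', hl', u', hu', h'⟩ := Cell.exists_lu hg'
    have hv := U.inv hu.1
    have hv' := U.inv hu'.1
    -- Conjugating `l` by `t` keeps it unipotent and moves `t` into the upper triangular factor.
    have e1 : diagonal t * l * diagonal (fun i => (t i)⁻¹) * (diagonal t * u⁻¹) = l' * u'⁻¹ := by
      rw [← h', e, h, mul_assoc _ (Matrix.diagonal _), ← mul_assoc (Matrix.diagonal _),
        diagonal_mul_diagonal]
      simp [ht, mul_assoc]
    have e2 := (lu_unique (L.diagonal_conj hl htt) hl' ((isUpper_diagonal t).mul (U.isUpper hv))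
      (U.isUpper hv') ((isUnit_diagonal ht).mul (U.isUnit hv)) e1).2
    intro i
    obtain ⟨r, hr, h1⟩ := hv.2.1 i
    obtain ⟨r', hr', h2⟩ := hv'.2.1 i
    have e3 := congrFun (congrFun e2 i) i
    rw [diagonal_mul, h1, h2] at e3
    refine ⟨r' / r, div_pos hr' hr, ?_⟩
    push_cast
    rw [eq_div_iff (by exact_mod_cast hr.ne'), e3]
  obtain ⟨l, hl, k, hk, h⟩ := hg
  obtain ⟨l', hl', k', hk', h'⟩ := hg'
  have hb : PosLower (diagonal t * l) := by
    refine ⟨(isLower_diagonal t).mul (L.isLower hl), fun i => ?_⟩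
    rw [diagonal_mul, hl.2, mul_one]; exact hpos i
  have e1 : l' = diagonal t * l := by
    rw [← gramLow_mul hl' hk', ← h', e, h, ← mul_assoc, gramLow_eq hb hk.1.1]
  have e2 : diagonal t = (1 : Mat n) := by
    rw [← diagonal_one]; congr 1; ext i
    have := congrFun (congrFun e1 i) i
    rw [diagonal_mul, hl'.2, hl.2, mul_one] at this
    exact this.symm
  rw [e, e2, one_mul]

/-- The torus element that moves a regular matrix into `Cell n`. -/
noncomputable def normalizer (g : Mat n) (i : Fin n) : ℂ :=
  (gramDiag g i)⁻¹ * (star (up g i i) * ((Real.sqrt (up g i i * star (up g i i)).re : ℝ) : ℂ)⁻¹)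

theorem up_diag_ne_zero {g : Mat n} (hg : Regular g) (i : Fin n) : up g i i ≠ 0 := by
  have hu := up_isUpper hg
  have := IsUpper.mul_diag hu (IsUpper.inv hu (up_isUnit hg)) i
  rw [mul_inv_of_isUnit (up_isUnit hg), one_apply_eq] at this
  exact left_ne_zero_of_mul (this ▸ one_ne_zero)

theorem phase_spec {v : ℂ} (hv : v ≠ 0) :
    ∃ r : ℝ, 0 < r ∧ r * r = Complex.normSq v ∧ ((Real.sqrt (v * star v).re : ℝ) : ℂ) = r :=
  ⟨_, Real.sqrt_pos.2 (Complex.normSq_pos.2 hv), Real.mul_self_sqrt (Complex.normSq_nonneg v), by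
    rw [show v * star v = (Complex.normSq v : ℂ) from Complex.mul_conj v, Complex.ofReal_re]⟩

theorem normalizer_ne_zero {g : Mat n} (hg : Regular g) (i : Fin n) : normalizer g i ≠ 0 := by
  have hv := up_diag_ne_zero hg i
  obtain ⟨r, hr, -, h⟩ := phase_spec hv
  rw [normalizer, h]
  exact mul_ne_zero (inv_ne_zero (gramDiag_ne_zero hg.1 i))
    (mul_ne_zero (star_ne_zero.2 hv) (inv_ne_zero (by exact_mod_cast hr.ne')))

/-- Write `t = β⁻¹ θ` with `θ` unimodular. The factor `β⁻¹` cancels the diagonal of the Gram–Schmidt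
factor, while `θ` is absorbed by the unitary factor and makes the diagonal of the upper factor
positive. No assumption on `det g` is needed: the determinant is normalized along the way. -/
theorem normalizer_mul_mem {g : Mat n} (hg : Regular g) : diagonal (normalizer g) * g ∈ Cell n := by
  obtain ⟨q, hq, hgq⟩ := gramLow_spec hg.1
  have hv := up_diag_ne_zero hg
  choose r hr hrr hrs using fun i => phase_spec (hv i)
  set β := gramDiag g with hβ
  have hβ0 : ∀ i, β i ≠ 0 := gramDiag_ne_zero hg.1
  set θ : Fin n → ℂ := fun i => star (up g i i) * (r i : ℂ)⁻¹ with hθ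
  have hr0 : ∀ i, (r i : ℂ) ≠ 0 := fun i => by exact_mod_cast (hr i).ne'
  have hθ1 : ∀ i, θ i * star (θ i) = 1 := fun i => by
    have e : star (up g i i) * up g i i = r i * r i := by
      rw [mul_comm, show up g i i * star (up g i i) = (Complex.normSq (up g i i) : ℂ) from
        Complex.mul_conj _, ← hrr i, Complex.ofReal_mul]
    have : star ((r i : ℂ)⁻¹) = (r i : ℂ)⁻¹ := by
      rw [star_inv₀]; congr 1; exact Complex.conj_ofReal _
    rw [hθ]; simp only [star_mul', star_star, this]
    rw [mul_mul_mul_comm, e]; have := hr0 i; field_simp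
  set t := normalizer g with ht
  have htt : ∀ i, t i = (β i)⁻¹ * θ i := fun i => by rw [ht, normalizer, hrs]
  have ht0 : ∀ i, t i ≠ 0 := normalizer_ne_zero hg
  have hlow := low_mem (Regular.gram hg.1)
  set l := diagonal t * low (g * gᴴ) * Matrix.diagonal fun i => β i * star (θ i) with hl
  have hlL : l ∈ L n := L.diagonal_conj hlow fun i => by
    rw [htt, mul_mul_mul_comm, hθ1, inv_mul_cancel₀ (hβ0 i), mul_one]
  set k := diagonal θ * q with hk
  have hθu : diagonal θ * (diagonal θ)ᴴ = (1 : Mat n) := by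
    rw [diagonal_conjTranspose, diagonal_mul_diagonal, ← diagonal_one]
    congr 1; ext i; exact hθ1 i
  have hkU : k ∈ unitaryGroup (Fin n) ℂ := mul_mem (mem_unitaryGroup_iff.2 hθu) hq
  have e : diagonal t * g = l * k := by
    have h1 : (Matrix.diagonal fun i => β i * star (θ i)) * Matrix.diagonal θ =
        (diagonal β : Mat n) := by
      rw [diagonal_mul_diagonal]; congr 1; ext i
      rw [mul_assoc, mul_comm (star _), hθ1, mul_one]
    conv_lhs => rw [hgq, gramLow, ← hβ, ← h1]
    simp only [hl, hk, mul_assoc]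
  have hl2 : diagonal t * low g * (Matrix.diagonal fun i => (t i)⁻¹) ∈ L n :=
    L.diagonal_conj (low_mem hg) fun i => mul_inv_cancel₀ (ht0 i)
  set u := diagonal t * up g with hu
  have e2 : k = l⁻¹ * (diagonal t * low g * Matrix.diagonal fun i => (t i)⁻¹) * u := by
    refine mul_left_cancel_of_isUnit (L.isUnit hlL) ?_
    rw [← e, ← mul_assoc, ← mul_assoc l, mul_inv_of_isUnit (L.isUnit hlL), one_mul, hu, ← mul_assoc,
      mul_assoc (diagonal t * low g), diagonal_mul_diagonal]
    simp only [ne_eq, ht0, not_false_eq_true, inv_mul_cancel₀, diagonal_one, mul_one]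
    rw [mul_assoc, low_mul_up hg]
  have hmL := L.mul (L.inv hlL) hl2
  have huU : u.IsUpperTriangular := (isUpper_diagonal t).mul (up_isUpper hg)
  have hup : ∀ i, ∃ s : ℝ, 0 < s ∧ u i i = s := fun i => by
    obtain ⟨s, hs, h⟩ := gramDiag_pos hg.1 i
    refine ⟨s⁻¹ * r i, mul_pos (inv_pos.2 hs) (hr i), ?_⟩
    have e3 : star (up g i i) * up g i i = r i * r i := by
      rw [mul_comm, show up g i i * star (up g i i) = (Complex.normSq (up g i i) : ℂ) from
        Complex.mul_conj _, ← hrr i, Complex.ofReal_mul]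
    rw [hu, diagonal_mul, htt, hθ, hβ, h]
    push_cast
    rw [mul_assoc, mul_right_comm, e3, mul_assoc (r i : ℂ), mul_inv_cancel₀ (hr0 i), mul_one]
  -- The unitary `k` and the positive upper triangular `u` differ by an element of `L`, so their
  -- common determinant is both unimodular and positive.
  have hdet : u.det = 1 := by
    obtain ⟨s, hs, h⟩ := exists_det_eq_of_diag_pos (det_of_isUpperTriangular huU) hup
    have h2 : k.det = u.det := by rw [e2, det_mul, L.det hmL, one_mul]
    exact eq_one_of_mul_eq_one_of_pos (h2 ▸ det_of_mem_unitary hkU) hs h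
  refine ⟨l, hlL, k, ⟨⟨hkU, ?_⟩, _, hmL, u, ⟨fun i j h => huU h, hup, hdet⟩, e2⟩, e⟩
  rw [e2, det_mul, L.det hmL, hdet, one_mul]

/-- The triangular factor in the factorization of a matrix as `k u`. -/
noncomputable def gramUp (m : Mat n) : Mat n := (gramLow mᴴ)ᴴ

theorem gramUp_eq {k u : Mat n} (hk : k ∈ K n) (hu : u ∈ U n) : gramUp (k * u) = u := by
  have hb : PosLower uᴴ := ⟨isLower_conjTranspose (U.isUpper hu), fun i => by
    obtain ⟨r, hr, h⟩ := hu.2.1 i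
    exact ⟨r, hr, by rw [conjTranspose_apply, h]; exact Complex.conj_ofReal r⟩⟩
  have hq : kᴴ ∈ unitaryGroup (Fin n) ℂ := Unitary.star_mem hk.1
  rw [gramUp, conjTranspose_mul, gramLow_eq hb hq, conjTranspose_conjTranspose]

/-- Gram–Schmidt for `mᴴ` gives `m = k u`. Since `det m = 1`, the determinant of `k` is unimodular
and positive, hence one. Then `k = m u⁻¹` is itself an LU factorization, so `k ∈ C`. -/
theorem L.exists_mul {m : Mat n} (hm : m ∈ L n) : ∃ k ∈ C n, ∃ u ∈ D n, m = k * u := by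
  have hu := isUnit_conjTranspose (L.isUnit hm)
  obtain ⟨q, hq, e⟩ := gramLow_spec hu
  have hb := gramLow_posLower hu
  have e1 : m = qᴴ * gramUp m := by
    rw [gramUp, ← conjTranspose_mul, ← e, conjTranspose_conjTranspose]
  have hup : (gramUp m).IsUpperTriangular := isUpper_conjTranspose hb.1
  have hpos : ∀ i, ∃ r : ℝ, 0 < r ∧ gramUp m i i = r := fun i => by
    obtain ⟨r, hr, h⟩ := hb.2 i
    exact ⟨r, hr, by rw [gramUp, conjTranspose_apply, h]; exact Complex.conj_ofReal r⟩
  have hqU : qᴴ ∈ unitaryGroup (Fin n) ℂ := Unitary.star_mem hq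
  obtain ⟨r, hr, h⟩ := exists_det_eq_of_diag_pos (det_of_isUpperTriangular hup) hpos
  have hd := congrArg Matrix.det e1
  rw [det_mul, L.det hm, h] at hd
  have hdq : (qᴴ).det = 1 :=
    eq_one_of_mul_eq_one_of_pos (det_of_mem_unitary hqU) (inv_pos.2 hr)
      (by push_cast; exact eq_inv_of_mul_eq_one_left hd.symm)
  have hK : qᴴ ∈ K n := ⟨hqU, hdq⟩
  have hU : gramUp m ∈ U n := ⟨fun i j hij => hup hij, hpos, by rw [h, ← one_mul (r : ℂ), ← hdq, ← hd, hdq]⟩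
  refine ⟨qᴴ, ⟨hK, m, hm, (gramUp m)⁻¹, U.inv hU, ?_⟩, gramUp m, ⟨hU, m, hm, qᴴ, hK, e1⟩, e1⟩
  rw [show m * (gramUp m)⁻¹ = qᴴ * gramUp m * (gramUp m)⁻¹ from congrArg (· * (gramUp m)⁻¹) e1,
    mul_assoc, mul_inv_of_isUnit (U.isUnit hU), mul_one]

end TodaLU

namespace TodaLU

open Matrix

/-! ### Analyticity of matrix operations -/

variable {n : ℕ} {E : Type*} [NormedAddCommGroup E] [NormedSpace ℝ E] {x : E}

theorem analyticAt_matrix_iff {f : E → Mat n} :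
    AnalyticAt ℝ f x ↔ ∀ i j, AnalyticAt ℝ (fun y => f y i j) x := by
  refine ⟨fun h i j => ?_, fun h => ?_⟩
  · exact analyticAt_pi_iff.1 ((analyticAt_pi_iff (f := fun i y => f y i)).1 h i) j
  · exact AnalyticAt.pi (f := fun i y => f y i) fun i => AnalyticAt.pi fun j => h i j

theorem analyticAt_matrix_mul {f g : E → Mat n} (hf : AnalyticAt ℝ f x) (hg : AnalyticAt ℝ g x) :
    AnalyticAt ℝ (fun y => f y * g y) x := by
  rw [analyticAt_matrix_iff] at *
  intro i j
  simp only [Matrix.mul_apply]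
  exact Finset.analyticAt_fun_sum _ fun k _ => (hf i k).mul (hg k j)

theorem analyticAt_star {f : E → ℂ} (hf : AnalyticAt ℝ f x) :
    AnalyticAt ℝ (fun y => star (f y)) x :=
  (Complex.conjCLE.toContinuousLinearMap.analyticAt (f x)).comp hf

theorem analyticAt_conjTranspose {f : E → Mat n} (hf : AnalyticAt ℝ f x) :
    AnalyticAt ℝ (fun y => (f y)ᴴ) x := by
  rw [analyticAt_matrix_iff] at *
  intro i j
  exact analyticAt_star (hf j i)

theorem analyticAt_det {f : E → Mat n} (hf : AnalyticAt ℝ f x) :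
    AnalyticAt ℝ (fun y => (f y).det) x := by
  rw [analyticAt_matrix_iff] at hf
  simp only [Matrix.det_apply']
  exact Finset.analyticAt_fun_sum _ fun σ _ =>
    analyticAt_const.mul (Finset.analyticAt_fun_prod _ fun i _ => hf _ _)

theorem analyticAt_matrix_inv {f : E → Mat n} (hf : AnalyticAt ℝ f x) (h : IsUnit (f x)) :
    AnalyticAt ℝ (fun y => (f y)⁻¹) x := by
  rw [analyticAt_matrix_iff]
  intro i j
  simp only [Matrix.inv_def, Ring.inverse_eq_inv', Matrix.smul_apply, smul_eq_mul,
    Matrix.adjugate_apply]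
  refine ((analyticAt_det hf).inv ((Matrix.isUnit_iff_isUnit_det _).1 h).ne_zero).mul
    (analyticAt_det ?_)
  rw [analyticAt_matrix_iff] at *
  intro a b
  simp only [Matrix.updateRow_apply]
  split_ifs
  · exact analyticAt_const
  · exact hf a b

theorem analyticAt_diagonal {t : E → Fin n → ℂ} (ht : ∀ i, AnalyticAt ℝ (fun y => t y i) x) :
    AnalyticAt ℝ (fun y => (diagonal (t y) : Mat n)) x := by
  rw [analyticAt_matrix_iff]
  intro i j
  simp only [Matrix.diagonal_apply]
  split_ifs
  · exact ht i
  · exact analyticAt_const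

theorem analyticAt_aeval (p : Polynomial ℂ) {f : E → Mat n} (hf : AnalyticAt ℝ f x) :
    AnalyticAt ℝ (fun y => Polynomial.aeval (f y) p) x := by
  induction p using Polynomial.induction_on with
  | C a => simp only [Polynomial.aeval_C]; exact analyticAt_const
  | add p q hp hq => simp only [map_add]; exact hp.add hq
  | monomial k a h =>
    simp only [pow_succ, ← mul_assoc, map_mul, Polynomial.aeval_X] at h ⊢
    exact analyticAt_matrix_mul h hf

theorem analyticAt_sqrt {f : E → ℝ} (hf : AnalyticAt ℝ f x) (h : 0 < f x) :
    AnalyticAt ℝ (fun y => Real.sqrt (f y)) x := by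
  have h0 : AnalyticAt ℝ (fun y => Real.log (f y) * (1 / 2)) x :=
    ((analyticAt_log h).comp hf).mul analyticAt_const
  have h1 : AnalyticAt ℝ (fun y => Real.exp (Real.log (f y) * (1 / 2))) x :=
    AnalyticAt.comp (g := Real.exp) analyticAt_rexp h0
  refine h1.congr ?_
  filter_upwards [hf.continuousAt.eventually (lt_mem_nhds h)] with y hy
  rw [Real.sqrt_eq_rpow, Real.rpow_def_of_pos hy]

theorem analyticAt_sqrt_re {f : E → ℂ} (hf : AnalyticAt ℝ f x) (h : 0 < (f x).re) :
    AnalyticAt ℝ (fun y => ((Real.sqrt (f y).re : ℝ) : ℂ)) x :=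
  (Complex.ofRealCLM.analyticAt _).comp
    (analyticAt_sqrt ((Complex.reCLM.analyticAt _).comp hf) h)

/-! ### Analyticity of the triangular factorizations. -/

theorem analyticAt_pad (i : Fin n) {f : E → Mat n} (hf : AnalyticAt ℝ f x) :
    AnalyticAt ℝ (fun y => pad i (f y)) x :=
  (analyticAt_matrix_mul (analyticAt_matrix_mul analyticAt_const hf) analyticAt_const).add
    analyticAt_const

theorem analyticAt_lowInv {f : E → Mat n} (hf : AnalyticAt ℝ f x) (h : Regular (f x)) :
    AnalyticAt ℝ (fun y => lowInv (f y)) x := by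
  refine analyticAt_const.sub ?_
  rw [analyticAt_matrix_iff]
  intro i j
  exact analyticAt_matrix_iff.1 (analyticAt_matrix_mul (analyticAt_matrix_mul hf analyticAt_const)
    (analyticAt_matrix_inv (analyticAt_pad i hf) (h.2 i))) i j

theorem analyticAt_low {f : E → Mat n} (hf : AnalyticAt ℝ f x) (h : Regular (f x)) :
    AnalyticAt ℝ (fun y => low (f y)) x :=
  analyticAt_matrix_inv (analyticAt_lowInv hf h) (L.isUnit (lowInv_mem h))

theorem analyticAt_gramDiag {f : E → Mat n} (hf : AnalyticAt ℝ f x) (h : IsUnit (f x))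
    (i : Fin n) : AnalyticAt ℝ (fun y => gramDiag (f y) i) x := by
  have h1 := analyticAt_matrix_mul (analyticAt_lowInv (analyticAt_matrix_mul hf
    (analyticAt_conjTranspose hf)) (Regular.gram h)) hf
  exact analyticAt_sqrt_re (analyticAt_matrix_iff.1
    (analyticAt_matrix_mul h1 (analyticAt_conjTranspose h1)) i i)
    (mul_conjTranspose_diag_pos ((L.isUnit (lowInv_mem (Regular.gram h))).mul h) i)

theorem analyticAt_gramLow {f : E → Mat n} (hf : AnalyticAt ℝ f x) (h : IsUnit (f x)) :
    AnalyticAt ℝ (fun y => gramLow (f y)) x :=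
  analyticAt_matrix_mul (analyticAt_low (analyticAt_matrix_mul hf
    (analyticAt_conjTranspose hf)) (Regular.gram h)) (analyticAt_diagonal (analyticAt_gramDiag hf h))

theorem analyticAt_gramUp {f : E → Mat n} (hf : AnalyticAt ℝ f x) (h : IsUnit (f x)) :
    AnalyticAt ℝ (fun y => gramUp (f y)) x :=
  analyticAt_conjTranspose
    (analyticAt_gramLow (analyticAt_conjTranspose hf) (isUnit_conjTranspose h))

theorem analyticAt_normalizer {f : E → Mat n} (hf : AnalyticAt ℝ f x) (h : Regular (f x))
    (i : Fin n) : AnalyticAt ℝ (fun y => normalizer (f y) i) x := by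
  have hv := analyticAt_matrix_iff.1 (analyticAt_matrix_mul (analyticAt_lowInv hf h) hf) i i
  have hne := up_diag_ne_zero h i
  refine ((analyticAt_gramDiag hf h.1 i).inv (gramDiag_ne_zero h.1 i)).mul
    ((analyticAt_star hv).mul ((analyticAt_sqrt_re (hv.mul (analyticAt_star hv)) ?_).inv ?_))
  · exact Complex.normSq_pos.2 hne |>.trans_eq (congrArg Complex.re (Complex.mul_conj _)).symm
  · obtain ⟨r, hr, -, e⟩ := phase_spec hne
    exact e ▸ (by exact_mod_cast hr.ne')

theorem eventually_regular {f : E → Mat n} (hf : AnalyticAt ℝ f x) (h : Regular (f x)) :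
    ∀ᶠ y in nhds x, Regular (f y) := by
  have key : ∀ {g : E → Mat n}, AnalyticAt ℝ g x → IsUnit (g x) →
      ∀ᶠ y in nhds x, IsUnit (g y) := fun {g} hg hu => by
    simp only [Matrix.isUnit_iff_isUnit_det, isUnit_iff_ne_zero] at hu ⊢
    exact (analyticAt_det hg).continuousAt.eventually_ne hu
  exact (key hf h.1).and (Filter.eventually_all.2 fun i => key (analyticAt_pad i hf) (h.2 i))

/-! ### Conjugates of a diagonal matrix -/

theorem conj_inv_eq_iff {g X Λ : Mat n} (hg : IsUnit g) :
    X = conj g⁻¹ Λ ↔ g * X = Λ * g := by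
  rw [conj, nonsing_inv_nonsing_inv _ ((isUnit_iff_isUnit_det _).1 hg)]
  constructor
  · rintro rfl
    rw [mul_assoc, ← mul_assoc, mul_inv_of_isUnit hg, one_mul]
  · intro h
    rw [mul_assoc, ← h, ← mul_assoc, inv_mul_of_isUnit hg, one_mul]

theorem eq_diagonal_of_commute {d : Fin n → ℂ} (hd : Function.Injective d) {M : Mat n}
    (h : M * diagonal d = diagonal d * M) : M = diagonal fun i => M i i := by
  ext i j
  by_cases hij : i = j
  · subst hij; simp
  · rw [diagonal_apply_ne _ hij]
    have := congrFun (congrFun h i) j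
    rw [mul_diagonal, diagonal_mul, mul_comm, ← sub_eq_zero, ← sub_mul] at this
    exact (mul_eq_zero.1 this).resolve_left (sub_ne_zero.2 (hd.ne (Ne.symm hij)))

/-- Two frames of the same `X` differ by a matrix commuting with `diagonal d`, which is diagonal
because the eigenvalues are distinct. The cell contains only one frame of a torus orbit. -/
theorem Cell.eq_of_intertwine {d : Fin n → ℂ} (hd : Function.Injective d) {g g' X : Mat n}
    (hg : g ∈ Cell n) (hg' : g' ∈ Cell n) (e : g * X = diagonal d * g)
    (e' : g' * X = diagonal d * g') : g' = g := by
  have hu := Cell.isUnit hg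
  have h1 : g' * g⁻¹ * diagonal d = diagonal d * (g' * g⁻¹) := by
    calc g' * g⁻¹ * diagonal d = g' * g⁻¹ * (diagonal d * g) * g⁻¹ := by
          simp only [mul_assoc]; rw [mul_inv_of_isUnit hu, mul_one]
      _ = g' * (g⁻¹ * g) * X * g⁻¹ := by rw [← e]; simp only [mul_assoc]
      _ = diagonal d * (g' * g⁻¹) := by
          rw [inv_mul_of_isUnit hu, mul_one, e']; simp only [mul_assoc]
  have h2 := eq_diagonal_of_commute hd h1
  have hT : IsUnit (g' * g⁻¹) := (Cell.isUnit hg').mul (isUnit_inv hu)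
  refine Cell.eq_of_mul_diagonal hg hg' (t := fun i => (g' * g⁻¹) i i) (fun i => ?_) ?_
  · rw [h2, isUnit_iff_isUnit_det, det_diagonal, isUnit_iff_ne_zero, Finset.prod_ne_zero_iff] at hT
    exact hT i (Finset.mem_univ i)
  · rw [← h2, mul_assoc, inv_mul_of_isUnit hu, mul_one]

/-- Row `i` is the projection of row `i` of `g` to the left eigenspace of `X` for `d i`. -/
noncomputable def eigenframe (d : Fin n → ℂ) (g X : Mat n) : Mat n :=
  Matrix.of fun i j => (g * Polynomial.aeval X (Lagrange.basis Finset.univ d i)) i j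

/-- With `g` held fixed the eigenframe is polynomial in `X`. This gives an analytic choice of
eigenvectors near a point without an implicit function theorem. -/
theorem analyticAt_eigenframe (d : Fin n → ℂ) (g : Mat n) {f : E → Mat n}
    (hf : AnalyticAt ℝ f x) : AnalyticAt ℝ (fun y => eigenframe d g (f y)) x := by
  rw [analyticAt_matrix_iff]
  intro i j
  exact analyticAt_matrix_iff.1 (analyticAt_matrix_mul analyticAt_const (analyticAt_aeval _ hf)) i j

theorem mul_aeval_apply {d : Fin n → ℂ} {g X : Mat n} (e : g * X = diagonal d * g)
    (p : Polynomial ℂ) (i j : Fin n) :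
    (g * Polynomial.aeval X p) i j = p.eval (d i) * g i j := by
  suffices h : g * Polynomial.aeval X p = diagonal (fun i => p.eval (d i)) * g by
    rw [h, diagonal_mul]
  induction p using Polynomial.induction_on with
  | C a =>
    ext i j
    simp [Algebra.algebraMap_eq_smul_one]
  | add p q hp hq =>
    rw [map_add, mul_add, hp, hq, ← add_mul, diagonal_add]
    simp
  | monomial k a h =>
    rw [pow_succ, ← mul_assoc, map_mul, ← mul_assoc, h, Polynomial.aeval_X, mul_assoc, e, ← mul_assoc,
      diagonal_mul_diagonal]
    simp

theorem eigenframe_self {d : Fin n → ℂ} (hd : Function.Injective d) {g X : Mat n}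
    (e : g * X = diagonal d * g) : eigenframe d g X = g := by
  ext i j
  rw [eigenframe, of_apply, mul_aeval_apply e, Lagrange.eval_basis_self hd.injOn (Finset.mem_univ i),
    one_mul]

theorem aeval_nodal_of_intertwine {d : Fin n → ℂ} {g X : Mat n} (hg : IsUnit g)
    (e : g * X = diagonal d * g) : Polynomial.aeval X (Lagrange.nodal Finset.univ d) = 0 := by
  refine mul_left_cancel_of_isUnit hg ?_
  ext i j
  rw [mul_aeval_apply e, Lagrange.eval_nodal_at_node (Finset.mem_univ i)]
  simp

/-- The polynomial `(x - d i)` times the `i`-th Lagrange basis polynomial is a constant multiple of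
the nodal polynomial, which kills `X`. No relation between `g` and `X` is required, so `g` may be
the frame of a nearby point. -/
theorem eigenframe_mul {d : Fin n → ℂ} (g : Mat n) {X : Mat n}
    (h : Polynomial.aeval X (Lagrange.nodal Finset.univ d) = 0) :
    eigenframe d g X * X = diagonal d * eigenframe d g X := by
  ext i j
  have h1 : Lagrange.basis Finset.univ d i * (Polynomial.X - Polynomial.C (d i)) =
      Polynomial.C (Lagrange.nodalWeight Finset.univ d i) * Lagrange.nodal Finset.univ d := by
    rw [Lagrange.basis_eq_prod_sub_inv_mul_nodal_div (Finset.mem_univ i), mul_assoc,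
      Lagrange.nodal_eq_mul_nodal_erase (Finset.mem_univ i),
      mul_div_cancel_left₀ _ (Polynomial.X_sub_C_ne_zero _)]
    ring
  have h2 : Polynomial.aeval X (Lagrange.basis Finset.univ d i) * X =
      d i • Polynomial.aeval X (Lagrange.basis Finset.univ d i) := by
    have := congrArg (Polynomial.aeval X) h1
    rw [map_mul, map_mul, h, mul_zero, map_sub, Polynomial.aeval_X, Polynomial.aeval_C, mul_sub,
      sub_eq_zero, Algebra.algebraMap_eq_smul_one, mul_smul_comm, mul_one] at this
    exact this
  have h3 : (eigenframe d g X * X) i j =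
      (g * Polynomial.aeval X (Lagrange.basis Finset.univ d i) * X) i j := by
    rw [Matrix.mul_apply, Matrix.mul_apply]; rfl
  rw [h3, mul_assoc, h2, mul_smul_comm, diagonal_mul]
  rfl

/-! ### The affine space `Λ + 𝔩` and its identification with `L`. -/

theorem mem_affineLower_iff {d : Fin n → ℂ} {Y : Mat n} :
    Y ∈ affineLower (diagonal d) ↔ Y.IsLowerTriangular ∧ ∀ i, Y i i = d i := by
  constructor
  · rintro ⟨N, hN, rfl⟩
    refine ⟨fun i j (hij : i < j) => ?_, fun i => ?_⟩
    · simp [hN i j hij.le, diagonal_apply_ne _ hij.ne]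
    · simp [hN i i le_rfl]
  · rintro ⟨h1, h2⟩
    refine ⟨Y - diagonal d, fun i j hij => ?_, by abel⟩
    rcases hij.lt_or_eq with h | rfl
    · simp [show Y i j = 0 from h1 h, diagonal_apply_ne _ h.ne]
    · simp [h2]

theorem conj_inv_mem_affineLower {d : Fin n → ℂ} {l : Mat n} (hl : l ∈ L n) :
    conj l⁻¹ (diagonal d) ∈ affineLower (diagonal d) := by
  have hi := L.inv hl
  have h1 := (L.isLower hi).mul (isLower_diagonal d)
  rw [mem_affineLower_iff, conj,
    nonsing_inv_nonsing_inv _ ((isUnit_iff_isUnit_det _).1 (L.isUnit hl))]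
  refine ⟨h1.mul (L.isLower hl), fun i => ?_⟩
  rw [IsLower.mul_diag h1 (L.isLower hl), IsLower.mul_diag (L.isLower hi) (isLower_diagonal d),
    hl.2, hi.2, diagonal_apply_eq, one_mul, mul_one]

theorem aeval_of_mem_affineLower {d : Fin n → ℂ} {Y : Mat n} (hY : Y ∈ affineLower (diagonal d))
    (p : Polynomial ℂ) : (Polynomial.aeval Y p).IsLowerTriangular ∧
      ∀ i, (Polynomial.aeval Y p) i i = p.eval (d i) := by
  rw [mem_affineLower_iff] at hY
  induction p using Polynomial.induction_on with
  | C a =>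
    rw [Polynomial.aeval_C]
    refine ⟨isLower_diagonal _, fun i => by simp [Algebra.algebraMap_eq_smul_one]⟩
  | add p q hp hq =>
    rw [map_add]
    exact ⟨hp.1.add hq.1, fun i => by rw [Matrix.add_apply, hp.2, hq.2, Polynomial.eval_add]⟩
  | monomial k a h =>
    rw [pow_succ, ← mul_assoc, map_mul, Polynomial.aeval_X]
    exact ⟨h.1.mul hY.1, fun i => by
      rw [IsLower.mul_diag h.1 hY.1, h.2, hY.2, Polynomial.eval_mul_X]⟩

/-- A polynomial in `Y` is lower triangular with diagonal entries `p (d i)`, and the `i`-th basis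
polynomial is one at `d i`. Thus `eigenframe d 1` is a polynomial inverse of `l ↦ Λ ^ (l⁻¹)`. -/
theorem eigenframe_one_mem {d : Fin n → ℂ} (hd : Function.Injective d) {Y : Mat n}
    (hY : Y ∈ affineLower (diagonal d)) : eigenframe d 1 Y ∈ L n := by
  refine ⟨fun i j hij => ?_, fun i => ?_⟩ <;> rw [eigenframe, of_apply, one_mul]
  · exact (aeval_of_mem_affineLower hY _).1 hij
  · rw [(aeval_of_mem_affineLower hY _).2, Lagrange.eval_basis_self hd.injOn (Finset.mem_univ i)]

theorem eigenframe_one_mul {d : Fin n → ℂ} {Y : Mat n} (hY : Y ∈ affineLower (diagonal d)) :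
    eigenframe d 1 Y * Y = diagonal d * eigenframe d 1 Y := by
  refine eigenframe_mul 1 ?_
  rw [mem_affineLower_iff] at hY
  have h := Matrix.aeval_self_charpoly Y
  -- By Cayley–Hamilton it suffices that the characteristic polynomial is the nodal polynomial;
  -- transposing makes `Y` upper triangular.
  have hc : Yᵀ.charpoly = ∏ i, (Polynomial.X - Polynomial.C (Yᵀ i i)) :=
    Matrix.charpoly_of_isUpperTriangular Yᵀ fun _ _ hij => hY.1 hij
  rw [← Matrix.charpoly_transpose, hc] at h
  simpa [Lagrange.nodal_eq, hY.2] using h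

theorem Cell.of_L {l : Mat n} (hl : l ∈ L n) : l ∈ Cell n := ⟨l, hl, 1, C.one, (mul_one l).symm⟩

theorem eigenframe_one_conj {d : Fin n → ℂ} (hd : Function.Injective d) {l : Mat n}
    (hl : l ∈ L n) : eigenframe d 1 (conj l⁻¹ (diagonal d)) = l :=
  Cell.eq_of_intertwine hd (Cell.of_L hl)
    (Cell.of_L (eigenframe_one_mem hd (conj_inv_mem_affineLower hl)))
    ((conj_inv_eq_iff (L.isUnit hl)).1 rfl) (eigenframe_one_mul (conj_inv_mem_affineLower hl))

theorem conj_eigenframe_one {d : Fin n → ℂ} (hd : Function.Injective d) {Y : Mat n}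
    (hY : Y ∈ affineLower (diagonal d)) : conj (eigenframe d 1 Y)⁻¹ (diagonal d) = Y :=
  ((conj_inv_eq_iff (L.isUnit (eigenframe_one_mem hd hY))).2 (eigenframe_one_mul hY)).symm

end TodaLU

namespace TodaLU

open Matrix

/-! ### The open cell of the conjugacy class -/

variable {n : ℕ} {d : Fin n → ℂ}

theorem conj_conj (a b X : Mat n) : conj a (conj b X) = conj (a * b) X := by
  simp only [conj, Matrix.mul_inv_rev, mul_assoc]

theorem inv_inv_of_isUnit {g : Mat n} (h : IsUnit g) : g⁻¹⁻¹ = g :=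
  nonsing_inv_nonsing_inv _ ((isUnit_iff_isUnit_det _).1 h)

theorem mul_inv_inv {l u : Mat n} (hu : IsUnit u) : (l * u⁻¹)⁻¹ = u * l⁻¹ := by
  rw [Matrix.mul_inv_rev, inv_inv_of_isUnit hu]

theorem Cell.eq_of_conj (hd : Function.Injective d) {g g' : Mat n} (hg : g ∈ Cell n)
    (hg' : g' ∈ Cell n) (e : conj g⁻¹ (diagonal d) = conj g'⁻¹ (diagonal d)) : g = g' :=
  Cell.eq_of_intertwine hd hg' hg ((conj_inv_eq_iff (Cell.isUnit hg')).1 rfl)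
    ((conj_inv_eq_iff (Cell.isUnit hg)).1 e.symm)

theorem Cell.eq_of_mul_eq {l k l' k' : Mat n} (hl : l ∈ L n) (hk : k ∈ C n) (hl' : l' ∈ L n)
    (hk' : k' ∈ C n) (e : l * k = l' * k') : l = l' ∧ k = k' := by
  have h : l = l' := by rw [← gramLow_mul hl hk, e, gramLow_mul hl' hk']
  subst h
  exact ⟨rfl, mul_left_cancel_of_isUnit (L.isUnit hl) e⟩

theorem Cell.eq_of_mul_inv_eq {l u l' u' : Mat n} (hl : l ∈ L n) (hu : u ∈ D n) (hl' : l' ∈ L n)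
    (hu' : u' ∈ D n) (e : l * u⁻¹ = l' * u'⁻¹) : l = l' ∧ u = u' := by
  have h : l = l' := by rw [← low_mul_inv hl hu, e, low_mul_inv hl' hu']
  subst h
  refine ⟨rfl, ?_⟩
  rw [← inv_inv_of_isUnit (D.isUnit hu), mul_left_cancel_of_isUnit (L.isUnit hl) e,
    inv_inv_of_isUnit (D.isUnit hu')]

theorem injOn_PhiC (hd : Function.Injective d) : InjOn (PhiC (diagonal d)) (C n ×ˢ L n) := by
  rintro ⟨k, l⟩ ⟨hk, hl⟩ ⟨k', l'⟩ ⟨hk', hl'⟩ e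
  obtain ⟨h1, h2⟩ := Cell.eq_of_mul_eq hl hk hl' hk'
    (Cell.eq_of_conj hd ⟨l, hl, k, hk, rfl⟩ ⟨l', hl', k', hk', rfl⟩ e)
  exact Prod.ext h2 h1

theorem injOn_PhiD (hd : Function.Injective d) : InjOn (PhiD (diagonal d)) (D n ×ˢ L n) := by
  rintro ⟨u, l⟩ ⟨hu, hl⟩ ⟨u', l'⟩ ⟨hu', hl'⟩ e
  simp only [PhiD, ← mul_inv_inv (D.isUnit hu), ← mul_inv_inv (D.isUnit hu')] at e
  obtain ⟨h1, h2⟩ := Cell.eq_of_mul_inv_eq hl hu hl' hu'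
    (Cell.eq_of_conj hd (Cell.of_lu hl hu) (Cell.of_lu hl' hu') e)
  exact Prod.ext h2 h1

theorem mem_domU_iff {Λ X : Mat n} : X ∈ domU Λ ↔ ∃ g ∈ Cell n, X = conj g⁻¹ Λ := by
  constructor
  · rintro ⟨⟨k, l⟩, ⟨hk, hl⟩, rfl⟩
    exact ⟨l * k, ⟨l, hl, k, hk, rfl⟩, rfl⟩
  · rintro ⟨_, ⟨l, hl, k, hk, rfl⟩, rfl⟩
    exact ⟨(k, l), ⟨hk, hl⟩, rfl⟩

theorem image_PhiD (Λ : Mat n) : PhiD Λ '' (D n ×ˢ L n) = domU Λ := by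
  ext X
  rw [mem_domU_iff]
  constructor
  · rintro ⟨⟨u, l⟩, ⟨hu, hl⟩, rfl⟩
    exact ⟨l * u⁻¹, Cell.of_lu hl hu, by rw [mul_inv_inv (D.isUnit hu)]; rfl⟩
  · rintro ⟨g, hg, rfl⟩
    obtain ⟨l, hl, u, hu, rfl⟩ := Cell.exists_lu hg
    exact ⟨(u, l), ⟨hu, hl⟩, by rw [mul_inv_inv (D.isUnit hu)]; rfl⟩

/-- Diagonal matrices commute with `diagonal d`, so rescaling a frame gives a frame of the same `X`.
Membership in `𝒰` thus only requires some regular frame. -/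
theorem mem_domU_of_regular {g X : Mat n} (hg : Regular g) (e : g * X = diagonal d * g) :
    diagonal (normalizer g) * g * X = diagonal d * (diagonal (normalizer g) * g) ∧
      X ∈ domU (diagonal d) := by
  have h : diagonal (normalizer g) * g * X = diagonal d * (diagonal (normalizer g) * g) := by
    rw [mul_assoc, e, ← mul_assoc, ← mul_assoc, diagonal_mul_diagonal, diagonal_mul_diagonal]
    simp only [mul_comm]
  exact ⟨h, mem_domU_iff.2 ⟨_, normalizer_mul_mem hg,
    (conj_inv_eq_iff (Cell.isUnit (normalizer_mul_mem hg))).2 h⟩⟩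

theorem aeval_nodal_of_mem_conjClass {X : Mat n} (hX : X ∈ conjClass (diagonal d)) :
    Polynomial.aeval X (Lagrange.nodal Finset.univ d) = 0 := by
  obtain ⟨g, hg, rfl⟩ := hX
  have hu := isUnit_of_det_eq_one hg
  refine aeval_nodal_of_intertwine (isUnit_inv hu) ((conj_inv_eq_iff (isUnit_inv hu)).1 ?_)
  rw [inv_inv_of_isUnit hu]

theorem domU_subset_conjClass (Λ : Mat n) : domU Λ ⊆ conjClass Λ := by
  intro X hX
  obtain ⟨g, hg, rfl⟩ := mem_domU_iff.1 hX
  exact ⟨g⁻¹, by rw [det_nonsing_inv, Cell.det hg, Ring.inverse_one], rfl⟩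

theorem affineLower_subset_domU (hd : Function.Injective d) :
    affineLower (diagonal d) ⊆ domU (diagonal d) := fun _ hY =>
  mem_domU_iff.2 ⟨_, Cell.of_L (eigenframe_one_mem hd hY), (conj_eigenframe_one hd hY).symm⟩

/-! ### Openness and density. -/

theorem eventually_regular_eigenframe (hd : Function.Injective d) {g X₀ : Mat n} (hg : g ∈ Cell n)
    (e : X₀ = conj g⁻¹ (diagonal d)) : ∀ᶠ X in nhds X₀, Regular (eigenframe d g X) := by
  refine eventually_regular (analyticAt_eigenframe d g analyticAt_id) ?_
  rw [eigenframe_self hd ((conj_inv_eq_iff (Cell.isUnit hg)).1 e)]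
  exact Cell.regular hg

theorem exists_isOpen_domU (hd : Function.Injective d) :
    ∃ V : Set (Mat n), IsOpen V ∧ domU (diagonal d) = conjClass (diagonal d) ∩ V := by
  -- The largest open set whose trace on the conjugacy class lies in `𝒰`; it remains to see that it
  -- contains `𝒰`.
  refine ⟨interior (domU (diagonal d) ∪ (conjClass (diagonal d))ᶜ), isOpen_interior,
    Subset.antisymm (fun X hX => ⟨domU_subset_conjClass _ hX, ?_⟩) ?_⟩
  · obtain ⟨g, hg, e⟩ := mem_domU_iff.1 hX
    rw [mem_interior_iff_mem_nhds]
    filter_upwards [eventually_regular_eigenframe hd hg e] with Y hY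
    by_cases h : Y ∈ conjClass (diagonal d)
    · exact Or.inl (mem_domU_of_regular hY (eigenframe_mul g (aeval_nodal_of_mem_conjClass h))).2
    · exact Or.inr h
  · rintro X ⟨h1, h2⟩
    exact (interior_subset h2).resolve_right fun h => h h1

/-- The segment from `h` to the identity matrix. -/
def segmentToOne (h : Mat n) (t : ℝ) : Mat n :=
  ((1 - t : ℝ) : ℂ) • h + ((t : ℝ) : ℂ) • (1 : Mat n)

theorem analyticAt_segment (h : Mat n) (t : ℝ) : AnalyticAt ℝ (segmentToOne h) t := by
    rw [analyticAt_matrix_iff]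
    intro i j
    exact ((((Complex.ofRealCLM.analyticAt _).comp (analyticAt_const.sub analyticAt_id)).mul
      analyticAt_const).add ((Complex.ofRealCLM.analyticAt _).mul analyticAt_const))

/-- Each determinant involved is analytic in `t` and equals one at `t = 1`, so it does not vanish
identically and its zeros are isolated. The value `t = 0` is excluded because `h` itself is
arbitrary. -/
theorem eventually_regular_segment {h : Mat n} :
    ∀ᶠ t in nhdsWithin (0 : ℝ) {0}ᶜ, Regular (segmentToOne h t) := by
  set f := segmentToOne h with hf
  have hfa : ∀ t, AnalyticAt ℝ f t := analyticAt_segment h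
  have key : ∀ {g : ℝ → Mat n}, (∀ t, AnalyticAt ℝ g t) → g 1 = 1 →
      ∀ᶠ t in nhdsWithin (0 : ℝ) {0}ᶜ, IsUnit (g t) := fun {g} hg h1 => by
    simp only [isUnit_iff_isUnit_det, isUnit_iff_ne_zero]
    have ha : AnalyticOnNhd ℝ (fun t => (g t).det) univ := fun t _ => analyticAt_det (hg t)
    refine (ha 0 (mem_univ 0)).eventually_eq_zero_or_eventually_ne_zero.resolve_left fun h0 => ?_
    have := ha.eqOn_zero_of_preconnected_of_eventuallyEq_zero isPreconnected_univ (mem_univ 0) h0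
      (mem_univ 1)
    simp [h1] at this
  have hf1 : f 1 = 1 := by simp [hf, segmentToOne]
  exact (key hfa hf1).and (Filter.eventually_all.2 fun i =>
    key (fun t => analyticAt_pad i (hfa t)) (by simp only [hf1, pad_one]))

theorem analyticAt_conj {E : Type*} [NormedAddCommGroup E] [NormedSpace ℝ E] {x : E}
    {f g : E → Mat n} (hf : AnalyticAt ℝ f x) (hg : AnalyticAt ℝ g x) (h : IsUnit (f x)) :
    AnalyticAt ℝ (fun y => conj (f y) (g y)) x :=
  analyticAt_matrix_mul (analyticAt_matrix_mul hf hg) (analyticAt_matrix_inv hf h)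

/-- The frame `g⁻¹` is moved slightly along the segment to the identity. The moved frame need not
have determinant one, which is harmless since it is regular. -/
theorem conjClass_subset_closure (d : Fin n → ℂ) :
    conjClass (diagonal d) ⊆ closure (domU (diagonal d)) := by
  rintro X ⟨g, hg, rfl⟩
  have hu := isUnit_of_det_eq_one hg
  set f := segmentToOne g⁻¹ with hf
  have hf0 : f 0 = g⁻¹ := by simp [hf, segmentToOne]
  have hfa : AnalyticAt ℝ f 0 := analyticAt_segment _ 0
  have hfu : IsUnit (f 0) := hf0 ▸ isUnit_inv hu
  have hc : Filter.Tendsto (fun t => conj (f t)⁻¹ (diagonal d)) (nhdsWithin (0 : ℝ) {0}ᶜ)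
      (nhds (conj g (diagonal d))) := by
    have := (analyticAt_conj (analyticAt_matrix_inv hfa hfu) (analyticAt_const (v := diagonal d))
      (isUnit_inv hfu)).continuousAt.tendsto
    rw [hf0, inv_inv_of_isUnit hu] at this
    exact this.mono_left nhdsWithin_le_nhds
  refine mem_closure_of_tendsto hc ?_
  filter_upwards [eventually_regular_segment (h := g⁻¹)] with t ht
  exact (mem_domU_of_regular ht ((conj_inv_eq_iff ht.1).1 rfl)).2

/-! ### The frame of a point of the open cell -/

/-- The element `l k` of `L C` with `X = Λ ^ ((l k)⁻¹)`. -/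
noncomputable def frame (Λ X : Mat n) : Mat n :=
  (Function.invFunOn (PhiC Λ) (C n ×ˢ L n) X).2 * (Function.invFunOn (PhiC Λ) (C n ×ˢ L n) X).1

theorem frame_spec {Λ X : Mat n} (hX : X ∈ domU Λ) :
    frame Λ X ∈ Cell n ∧ X = conj (frame Λ X)⁻¹ Λ := by
  have h1 := Function.invFunOn_mem hX
  exact ⟨⟨_, h1.2, _, h1.1, rfl⟩, (Function.invFunOn_eq hX).symm⟩

theorem frame_eq (hd : Function.Injective d) {g X : Mat n} (hg : g ∈ Cell n)
    (e : X = conj g⁻¹ (diagonal d)) : frame (diagonal d) X = g := by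
  obtain ⟨h1, h2⟩ := frame_spec (mem_domU_iff.2 ⟨g, hg, e⟩)
  exact Cell.eq_of_conj hd h1 hg (h2.symm.trans e)

/-- Near `X₀`, the frame of `X` is the torus normalization of the eigenframe built from the fixed
frame at `X₀`. Both sides lie in the cell and intertwine `X` with `Λ`, so uniqueness identifies
them, but only for `X` in `𝒰`. -/
theorem analyticOn_frame (hd : Function.Injective d) :
    AnalyticOn ℝ (frame (diagonal d)) (domU (diagonal d)) := by
  intro X₀ hX₀
  obtain ⟨hg, e⟩ := frame_spec hX₀
  set g := frame (diagonal d) X₀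
  have hself := eigenframe_self hd ((conj_inv_eq_iff (Cell.isUnit hg)).1 e)
  have h1 : AnalyticAt ℝ (fun X => eigenframe d g X) X₀ := analyticAt_eigenframe d g analyticAt_id
  have h2 : AnalyticAt ℝ (fun X => diagonal (normalizer (eigenframe d g X)) * eigenframe d g X) X₀ :=
    analyticAt_matrix_mul (analyticAt_diagonal (analyticAt_normalizer h1
      (by rw [hself]; exact Cell.regular hg))) h1
  have h3 : ∀ᶠ X in nhdsWithin X₀ (domU (diagonal d)), frame (diagonal d) X =
      diagonal (normalizer (eigenframe d g X)) * eigenframe d g X := by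
    filter_upwards [nhdsWithin_le_nhds (eventually_regular_eigenframe hd hg e),
      self_mem_nhdsWithin] with X hX hXU
    have hm := normalizer_mul_mem hX
    exact frame_eq hd hm ((conj_inv_eq_iff (Cell.isUnit hm)).2 (mem_domU_of_regular hX
      (eigenframe_mul g (aeval_nodal_of_mem_conjClass (domU_subset_conjClass _ hXU)))).1)
  exact h2.analyticWithinAt.congr_of_eventuallyEq h3 (h3.self_of_nhdsWithin hX₀)

theorem analyticOn_comp_frame (hd : Function.Injective d) {F : Type*} [NormedAddCommGroup F]
    [NormedSpace ℝ F] {f : Mat n → F} (hf : ∀ g ∈ Cell n, AnalyticAt ℝ f g) :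
    AnalyticOn ℝ (fun X => f (frame (diagonal d) X)) (domU (diagonal d)) := fun X hX =>
  (hf _ (frame_spec hX).1).comp_analyticWithinAt (analyticOn_frame hd X hX)

theorem analyticAt_conj_gramLow {g : Mat n} (Λ : Mat n) (hg : g ∈ Cell n) :
    AnalyticAt ℝ (fun y => conj (gramLow y)⁻¹ Λ) g := by
  have hu : IsUnit (gramLow g) := by
    obtain ⟨l, hl, k, hk, rfl⟩ := hg
    rw [gramLow_mul hl hk]; exact L.isUnit hl
  exact analyticAt_conj (analyticAt_matrix_inv
    (analyticAt_gramLow (f := fun y => y) analyticAt_id (Cell.isUnit hg)) hu)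
    analyticAt_const (isUnit_inv hu)

theorem analyticAt_conj_low {g : Mat n} (Λ : Mat n) (hg : g ∈ Cell n) :
    AnalyticAt ℝ (fun y => conj (low y)⁻¹ Λ) g := by
  have hu := L.isUnit (low_mem (Cell.regular hg))
  exact analyticAt_conj (analyticAt_matrix_inv
    (analyticAt_low (f := fun y => y) analyticAt_id (Cell.regular hg)) hu)
    analyticAt_const (isUnit_inv hu)

/-! ### The coordinates -/

theorem phi_eq (hd : Function.Injective d) {l₁ k u l₂ X : Mat n} (hl₁ : l₁ ∈ L n) (hk : k ∈ C n)
    (hu : u ∈ D n) (hl₂ : l₂ ∈ L n) (e₁ : X = conj (l₁ * k)⁻¹ (diagonal d))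
    (e₂ : X = conj (u * l₂⁻¹) (diagonal d)) :
    phi (diagonal d) X = (conj l₁⁻¹ (diagonal d), conj l₂⁻¹ (diagonal d)) := by
  have h1 : Function.invFunOn (PhiC (diagonal d)) (C n ×ˢ L n) X = (k, l₁) := by
    rw [show X = PhiC (diagonal d) (k, l₁) from e₁]
    exact (injOn_PhiC hd).leftInvOn_invFunOn (show (k, l₁) ∈ C n ×ˢ L n from ⟨hk, hl₁⟩)
  have h2 : Function.invFunOn (PhiD (diagonal d)) (D n ×ˢ L n) X = (u, l₂) := by
    rw [show X = PhiD (diagonal d) (u, l₂) from e₂]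
    exact (injOn_PhiD hd).leftInvOn_invFunOn (show (u, l₂) ∈ D n ×ˢ L n from ⟨hu, hl₂⟩)
  rw [phi, h1, h2, PhiC, PhiD, mul_one, one_mul]

/-- This equivalence turns the two factorizations of one cell element into the `k u` factorization
of an element of `L`, which matches the cell with `L × L`. -/
theorem mul_eq_mul_inv_iff {l₁ k u l₂ : Mat n} (hl₁ : l₁ ∈ L n) (hu : u ∈ D n) :
    l₁⁻¹ * l₂ = k * u ↔ l₁ * k = l₂ * u⁻¹ := by
  have h1 := L.isUnit hl₁
  have h2 := D.isUnit hu
  constructor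
  · intro e
    rw [← one_mul l₂, ← mul_inv_of_isUnit h1, mul_assoc l₁, e, mul_assoc, mul_assoc,
      mul_inv_of_isUnit h2, mul_one]
  · intro e
    rw [← mul_one l₂, ← inv_mul_of_isUnit h2, ← mul_assoc l₂, ← e, mul_assoc, ← mul_assoc,
      inv_mul_of_isUnit h1, one_mul]

theorem phi_conj (hd : Function.Injective d) {l₁ k u l₂ : Mat n} (hl₁ : l₁ ∈ L n) (hk : k ∈ C n)
    (hu : u ∈ D n) (hl₂ : l₂ ∈ L n) (e : l₁⁻¹ * l₂ = k * u) :
    phi (diagonal d) (conj (l₁ * k)⁻¹ (diagonal d)) =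
      (conj l₁⁻¹ (diagonal d), conj l₂⁻¹ (diagonal d)) :=
  phi_eq hd hl₁ hk hu hl₂ rfl
    (by rw [(mul_eq_mul_inv_iff hl₁ hu).1 e, mul_inv_inv (D.isUnit hu)])

theorem exists_coordinates {Λ X : Mat n} (hX : X ∈ domU Λ) :
    ∃ l₁ ∈ L n, ∃ k ∈ C n, ∃ u ∈ D n, ∃ l₂ ∈ L n, frame Λ X = l₁ * k ∧ frame Λ X = l₂ * u⁻¹ ∧
      X = conj (l₁ * k)⁻¹ Λ ∧ l₁⁻¹ * l₂ = k * u := by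
  obtain ⟨hg, e⟩ := frame_spec hX
  obtain ⟨l₂, hl₂, u, hu, e₂⟩ := Cell.exists_lu hg
  obtain ⟨l₁, hl₁, k, hk, e₁⟩ := hg
  exact ⟨l₁, hl₁, k, hk, u, hu, l₂, hl₂, e₁, e₂, e₁ ▸ e,
    (mul_eq_mul_inv_iff hl₁ hu).2 (e₁.symm.trans e₂)⟩

/-- The inverses chosen in the definition of `phi` are replaced by explicit factor maps applied to
the frame, from which analyticity can be read off. -/
theorem phi_eq_frame (hd : Function.Injective d) {X : Mat n} (hX : X ∈ domU (diagonal d)) :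
    phi (diagonal d) X = (conj (gramLow (frame (diagonal d) X))⁻¹ (diagonal d),
      conj (low (frame (diagonal d) X))⁻¹ (diagonal d)) := by
  obtain ⟨l₁, hl₁, k, hk, u, hu, l₂, hl₂, e₁, e₂, e, e'⟩ := exists_coordinates hX
  conv_rhs => rw [e₁, gramLow_mul hl₁ hk, ← e₁, e₂, low_mul_inv hl₂ hu]
  conv_lhs => rw [e]
  exact phi_conj hd hl₁ hk hu hl₂ e'

/-- The inverse of `phi`. -/
noncomputable def psi (d : Fin n → ℂ) (p : Mat n × Mat n) : Mat n :=
  conj (gramUp ((eigenframe d 1 p.1)⁻¹ * eigenframe d 1 p.2)) p.2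

theorem psi_eq (hd : Function.Injective d) {l₁ k u l₂ : Mat n} (hl₁ : l₁ ∈ L n) (hk : k ∈ C n)
    (hu : u ∈ D n) (hl₂ : l₂ ∈ L n) (e : l₁⁻¹ * l₂ = k * u) :
    psi d (conj l₁⁻¹ (diagonal d), conj l₂⁻¹ (diagonal d)) =
        conj k⁻¹ (conj l₁⁻¹ (diagonal d)) ∧
      psi d (conj l₁⁻¹ (diagonal d), conj l₂⁻¹ (diagonal d)) =
        conj u (conj l₂⁻¹ (diagonal d)) := by
  have h : psi d (conj l₁⁻¹ (diagonal d), conj l₂⁻¹ (diagonal d)) =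
      conj u (conj l₂⁻¹ (diagonal d)) := by
    simp only [psi]
    rw [eigenframe_one_conj hd hl₁, eigenframe_one_conj hd hl₂, e, gramUp_eq hk.1 hu.1]
  refine ⟨?_, h⟩
  rw [h, conj_conj, conj_conj, ← mul_inv_inv (D.isUnit hu), ← (mul_eq_mul_inv_iff hl₁ hu).1 e,
    Matrix.mul_inv_rev]

theorem exists_eq_conj (hd : Function.Injective d) {Y : Mat n}
    (hY : Y ∈ affineLower (diagonal d)) : ∃ l ∈ L n, Y = conj l⁻¹ (diagonal d) :=
  ⟨_, eigenframe_one_mem hd hY, (conj_eigenframe_one hd hY).symm⟩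

theorem conj_mul_inv_mem_domU {Λ l k : Mat n} (hl : l ∈ L n) (hk : k ∈ C n) :
    conj (l * k)⁻¹ Λ ∈ domU Λ := mem_domU_iff.2 ⟨_, ⟨l, hl, k, hk, rfl⟩, rfl⟩

theorem analyticAt_psi (hd : Function.Injective d) {p : Mat n × Mat n}
    (hp : p ∈ affineLower (diagonal d) ×ˢ affineLower (diagonal d)) :
    AnalyticAt ℝ (psi d) p := by
  have h1 := eigenframe_one_mem hd hp.1
  have h2 := eigenframe_one_mem hd hp.2
  have hm := L.mul (L.inv h1) h2
  obtain ⟨k, hk, u, hu, e⟩ := L.exists_mul hm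
  refine analyticAt_conj (analyticAt_gramUp (analyticAt_matrix_mul (analyticAt_matrix_inv
    (analyticAt_eigenframe d 1 analyticAt_fst) (L.isUnit h1))
    (analyticAt_eigenframe d 1 analyticAt_snd)) (L.isUnit hm)) analyticAt_snd ?_
  rw [e, gramUp_eq hk.1 hu.1]
  exact D.isUnit hu

/-! ### The three diffeomorphisms. -/

theorem isRealAnalyticDiffeo_phi (hd : Function.Injective d) :
    IsRealAnalyticDiffeo (phi (diagonal d)) (psi d) (domU (diagonal d))
      (affineLower (diagonal d) ×ˢ affineLower (diagonal d)) where
  mapsTo X hX := by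
    obtain ⟨l₁, hl₁, k, hk, u, hu, l₂, hl₂, -, -, rfl, e⟩ := exists_coordinates hX
    rw [phi_conj hd hl₁ hk hu hl₂ e]
    exact ⟨conj_inv_mem_affineLower hl₁, conj_inv_mem_affineLower hl₂⟩
  mapsTo_inv := by
    rintro ⟨Y, Z⟩ ⟨hY, hZ⟩
    obtain ⟨l₁, hl₁, rfl⟩ := exists_eq_conj hd hY
    obtain ⟨l₂, hl₂, rfl⟩ := exists_eq_conj hd hZ
    obtain ⟨k, hk, u, hu, e⟩ := L.exists_mul (L.mul (L.inv hl₁) hl₂)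
    rw [(psi_eq hd hl₁ hk hu hl₂ e).1, conj_conj, ← Matrix.mul_inv_rev]
    exact conj_mul_inv_mem_domU hl₁ hk
  invOn := by
    constructor
    · intro X hX
      obtain ⟨l₁, hl₁, k, hk, u, hu, l₂, hl₂, -, -, rfl, e⟩ := exists_coordinates hX
      rw [phi_conj hd hl₁ hk hu hl₂ e, (psi_eq hd hl₁ hk hu hl₂ e).1, conj_conj,
        ← Matrix.mul_inv_rev]
    · rintro ⟨Y, Z⟩ ⟨hY, hZ⟩
      obtain ⟨l₁, hl₁, rfl⟩ := exists_eq_conj hd hY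
      obtain ⟨l₂, hl₂, rfl⟩ := exists_eq_conj hd hZ
      obtain ⟨k, hk, u, hu, e⟩ := L.exists_mul (L.mul (L.inv hl₁) hl₂)
      rw [(psi_eq hd hl₁ hk hu hl₂ e).1, conj_conj, ← Matrix.mul_inv_rev,
        phi_conj hd hl₁ hk hu hl₂ e]
  analyticOn := (analyticOn_comp_frame hd fun _ hg => (analyticAt_conj_gramLow (diagonal d) hg).prod
    (analyticAt_conj_low (diagonal d) hg)).congr fun _ hX => phi_eq_frame hd hX
  analyticOn_inv _ hp := (analyticAt_psi hd hp).analyticWithinAt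

theorem isRealAnalyticDiffeo_conj_inv (hd : Function.Injective d) :
    IsRealAnalyticDiffeo (fun p : Mat n × Mat n => conj p.1⁻¹ p.2)
      (fun X => ((gramLow (frame (diagonal d) X))⁻¹ * frame (diagonal d) X,
        conj (gramLow (frame (diagonal d) X))⁻¹ (diagonal d)))
      (C n ×ˢ affineLower (diagonal d)) (domU (diagonal d)) where
  mapsTo := by
    rintro ⟨k, Y⟩ ⟨hk, hY⟩
    obtain ⟨l, hl, rfl⟩ := exists_eq_conj hd hY
    simp only [conj_conj, ← Matrix.mul_inv_rev]
    exact conj_mul_inv_mem_domU hl hk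
  mapsTo_inv X hX := by
    obtain ⟨l, hl, k, hk, -, -, -, -, e, -, -, -⟩ := exists_coordinates hX
    simp only [e, gramLow_mul hl hk, ← mul_assoc, inv_mul_of_isUnit (L.isUnit hl), one_mul]
    exact ⟨hk, conj_inv_mem_affineLower hl⟩
  invOn := by
    constructor
    · rintro ⟨k, Y⟩ ⟨hk, hY⟩
      obtain ⟨l, hl, rfl⟩ := exists_eq_conj hd hY
      simp only [conj_conj, ← Matrix.mul_inv_rev]
      rw [frame_eq hd ⟨l, hl, k, hk, rfl⟩ rfl, gramLow_mul hl hk, ← mul_assoc,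
        inv_mul_of_isUnit (L.isUnit hl), one_mul]
    · intro X hX
      obtain ⟨l, hl, k, hk, -, -, -, -, e, -, e', -⟩ := exists_coordinates hX
      simp only [e, gramLow_mul hl hk, ← mul_assoc, inv_mul_of_isUnit (L.isUnit hl), one_mul]
      rw [conj_conj, ← Matrix.mul_inv_rev, ← e']
  analyticOn p hp := (analyticAt_conj (analyticAt_matrix_inv analyticAt_fst (C.isUnit hp.1))
    analyticAt_snd (isUnit_inv (C.isUnit hp.1))).analyticWithinAt
  analyticOn_inv := by
    refine analyticOn_comp_frame hd (f := fun g => ((gramLow g)⁻¹ * g,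
      conj (gramLow g)⁻¹ (diagonal d))) fun g hg => AnalyticAt.prod ?_
        (analyticAt_conj_gramLow (diagonal d) hg)
    refine analyticAt_matrix_mul (analyticAt_matrix_inv
      (analyticAt_gramLow (f := fun y => y) analyticAt_id (Cell.isUnit hg)) ?_) analyticAt_id
    obtain ⟨l, hl, k, hk, rfl⟩ := hg
    rw [gramLow_mul hl hk]; exact L.isUnit hl

theorem inv_mul_inv_mul {l u : Mat n} (hl : l ∈ L n) (hu : u ∈ D n) : (l * u⁻¹)⁻¹ * l = u := by
  rw [mul_inv_inv (D.isUnit hu), mul_assoc, inv_mul_of_isUnit (L.isUnit hl), mul_one]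

theorem isRealAnalyticDiffeo_conj (hd : Function.Injective d) :
    IsRealAnalyticDiffeo (fun p : Mat n × Mat n => conj p.1 p.2)
      (fun X => ((frame (diagonal d) X)⁻¹ * low (frame (diagonal d) X),
        conj (low (frame (diagonal d) X))⁻¹ (diagonal d)))
      (D n ×ˢ affineLower (diagonal d)) (domU (diagonal d)) where
  mapsTo := by
    rintro ⟨u, Z⟩ ⟨hu, hZ⟩
    obtain ⟨l, hl, rfl⟩ := exists_eq_conj hd hZ
    simp only [conj_conj, ← mul_inv_inv (D.isUnit hu)]
    exact mem_domU_iff.2 ⟨_, Cell.of_lu hl hu, rfl⟩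
  mapsTo_inv X hX := by
    obtain ⟨-, -, -, -, u, hu, l, hl, -, e, -, -⟩ := exists_coordinates hX
    simp only [e, low_mul_inv hl hu, inv_mul_inv_mul hl hu]
    exact ⟨hu, conj_inv_mem_affineLower hl⟩
  invOn := by
    constructor
    · rintro ⟨u, Z⟩ ⟨hu, hZ⟩
      obtain ⟨l, hl, rfl⟩ := exists_eq_conj hd hZ
      simp only [conj_conj, ← mul_inv_inv (D.isUnit hu)]
      rw [frame_eq hd (Cell.of_lu hl hu) rfl, low_mul_inv hl hu, inv_mul_inv_mul hl hu]
    · intro X hX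
      obtain ⟨-, -, -, -, u, hu, l, hl, -, e, -, -⟩ := exists_coordinates hX
      have e' := (frame_spec hX).2
      rw [e] at e'
      simp only [e, low_mul_inv hl hu, inv_mul_inv_mul hl hu]
      rw [conj_conj, ← mul_inv_inv (D.isUnit hu), ← e']
  analyticOn p hp :=
    (analyticAt_conj analyticAt_fst analyticAt_snd (D.isUnit hp.1)).analyticWithinAt
  analyticOn_inv := by
    refine analyticOn_comp_frame hd (f := fun g => (g⁻¹ * low g,
      conj (low g)⁻¹ (diagonal d))) fun g hg => AnalyticAt.prod ?_
        (analyticAt_conj_low (diagonal d) hg)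
    exact analyticAt_matrix_mul (analyticAt_matrix_inv (f := fun y => y) analyticAt_id
      (Cell.isUnit hg)) (analyticAt_low (f := fun y => y) analyticAt_id (Cell.regular hg))

/-! ### The remaining bijections and the slices of the product. -/

theorem bijOn_conj_inv (hd : Function.Injective d) :
    BijOn (fun l => conj l⁻¹ (diagonal d)) (L n) (affineLower (diagonal d)) :=
  BijOn.mk (fun _ hl => conj_inv_mem_affineLower hl)
    (fun _ hl _ hl' e => Cell.eq_of_conj hd (Cell.of_L hl) (Cell.of_L hl') e)
    fun _ hY => ⟨_, eigenframe_one_mem hd hY, conj_eigenframe_one hd hY⟩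

theorem existsUnique_mul {l : Mat n} (hl : l ∈ L n) :
    ∃! p : Mat n × Mat n, p.1 ∈ C n ∧ p.2 ∈ D n ∧ l = p.1 * p.2 := by
  obtain ⟨k, hk, u, hu, e⟩ := L.exists_mul hl
  refine ⟨(k, u), ⟨hk, hu, e⟩, ?_⟩
  rintro ⟨k', u'⟩ ⟨hk', hu', e'⟩
  simp only at hk' hu' e'
  have h : u' = u := by rw [← gramUp_eq hk'.1 hu'.1, ← e', e, gramUp_eq hk.1 hu.1]
  subst h
  have h1 := mul_inv_of_isUnit (D.isUnit hu)
  have h2 : k' = k := by rw [← mul_one k', ← h1, ← mul_assoc, ← e', e, mul_assoc, h1, mul_one]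
  rw [h2]

/-- Fixing `Y` fixes `l₁`. The slice is filled because, for any `l₂`, the element `l₁⁻¹ l₂` of `L`
has a factorization `k u`, and its `k` conjugates `Y` to the required point. -/
theorem phi_image_C (hd : Function.Injective d) {Y : Mat n} (hY : Y ∈ affineLower (diagonal d)) :
    phi (diagonal d) '' ((fun k => conj k⁻¹ Y) '' C n) = {Y} ×ˢ affineLower (diagonal d) := by
  obtain ⟨l₁, hl₁, rfl⟩ := exists_eq_conj hd hY
  ext ⟨Y', Z⟩
  constructor
  · rintro ⟨_, ⟨k, hk, rfl⟩, e⟩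
    simp only [conj_conj, ← Matrix.mul_inv_rev] at e
    obtain ⟨l₂, hl₂, u, hu, e₂⟩ := Cell.exists_lu ⟨l₁, hl₁, k, hk, rfl⟩
    rw [phi_conj hd hl₁ hk hu hl₂ ((mul_eq_mul_inv_iff hl₁ hu).2 e₂)] at e
    rw [← e]
    exact ⟨rfl, conj_inv_mem_affineLower hl₂⟩
  · rintro ⟨rfl, hZ⟩
    obtain ⟨l₂, hl₂, rfl⟩ := exists_eq_conj hd hZ
    obtain ⟨k, hk, u, hu, e⟩ := L.exists_mul (L.mul (L.inv hl₁) hl₂)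
    refine ⟨_, ⟨k, hk, rfl⟩, ?_⟩
    simp only [conj_conj, ← Matrix.mul_inv_rev]
    exact phi_conj hd hl₁ hk hu hl₂ e

theorem phi_image_D (hd : Function.Injective d) {Z : Mat n} (hZ : Z ∈ affineLower (diagonal d)) :
    phi (diagonal d) '' ((fun u => conj u Z) '' D n) = affineLower (diagonal d) ×ˢ {Z} := by
  obtain ⟨l₂, hl₂, rfl⟩ := exists_eq_conj hd hZ
  ext ⟨Y, Z'⟩
  constructor
  · rintro ⟨_, ⟨u, hu, rfl⟩, e⟩
    obtain ⟨l₁, hl₁, k, hk, e₂⟩ := Cell.of_lu hl₂ hu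
    simp only [conj_conj, ← mul_inv_inv (D.isUnit hu), e₂] at e
    rw [phi_conj hd hl₁ hk hu hl₂ ((mul_eq_mul_inv_iff hl₁ hu).2 e₂.symm)] at e
    rw [← e]
    exact ⟨conj_inv_mem_affineLower hl₁, rfl⟩
  · rintro ⟨hY, rfl⟩
    obtain ⟨l₁, hl₁, rfl⟩ := exists_eq_conj hd hY
    obtain ⟨k, hk, u, hu, e⟩ := L.exists_mul (L.mul (L.inv hl₁) hl₂)
    refine ⟨_, ⟨u, hu, rfl⟩, ?_⟩
    simp only [conj_conj, ← mul_inv_inv (D.isUnit hu), ← (mul_eq_mul_inv_iff hl₁ hu).1 e]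
    exact phi_conj hd hl₁ hk hu hl₂ e

end TodaLU
theorem mainTheorem8 (n : ℕ) (d : Fin n → ℂ) (hd : Function.Injective d) (htr : ∑ i, d i = 0)
    (Λ : TodaLU.Mat n) (hΛ : Λ = Matrix.diagonal d) :
    -- both parametrizations are injective with the same image `𝒰`, which contains `Λ + 𝔩`
    BijOn (TodaLU.PhiC Λ) (TodaLU.C n ×ˢ TodaLU.L n) (TodaLU.domU Λ) ∧
    BijOn (TodaLU.PhiD Λ) (TodaLU.D n ×ˢ TodaLU.L n) (TodaLU.domU Λ) ∧
    TodaLU.affineLower Λ ⊆ TodaLU.domU Λ ∧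
    -- `𝒰` is an open dense subset of the conjugacy class
    (∃ V : Set (TodaLU.Mat n), IsOpen V ∧ TodaLU.domU Λ = TodaLU.conjClass Λ ∩ V) ∧
    TodaLU.conjClass Λ ⊆ closure (TodaLU.domU Λ) ∧
    -- formula for `φ`
    (∀ l₁ ∈ TodaLU.L n, ∀ k ∈ TodaLU.C n, ∀ u ∈ TodaLU.D n, ∀ l₂ ∈ TodaLU.L n, ∀ X : TodaLU.Mat n,
      X = TodaLU.conj (l₁ * k)⁻¹ Λ → X = TodaLU.conj (u * l₂⁻¹) Λ →
      TodaLU.phi Λ X = (TodaLU.conj l₁⁻¹ Λ, TodaLU.conj l₂⁻¹ Λ)) ∧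
    -- `L` is identified with `Λ + 𝔩`, and every element of `L` is uniquely a product `k u`
    BijOn (fun l => TodaLU.conj l⁻¹ Λ) (TodaLU.L n) (TodaLU.affineLower Λ) ∧
    (∀ l ∈ TodaLU.L n, ∃! p : TodaLU.Mat n × TodaLU.Mat n,
      p.1 ∈ TodaLU.C n ∧ p.2 ∈ TodaLU.D n ∧ l = p.1 * p.2) ∧
    -- `φ` is a real analytic diffeomorphism with the stated inverse `ψ`
    (∃ ψ : TodaLU.Mat n × TodaLU.Mat n → TodaLU.Mat n,
      TodaLU.IsRealAnalyticDiffeo (TodaLU.phi Λ) ψ (TodaLU.domU Λ)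
        (TodaLU.affineLower Λ ×ˢ TodaLU.affineLower Λ) ∧
      ∀ l₁ ∈ TodaLU.L n, ∀ l₂ ∈ TodaLU.L n, ∀ k ∈ TodaLU.C n, ∀ u ∈ TodaLU.D n,
        l₁⁻¹ * l₂ = k * u → ∀ Y Z : TodaLU.Mat n,
        Y = TodaLU.conj l₁⁻¹ Λ → Z = TodaLU.conj l₂⁻¹ Λ →
        ψ (Y, Z) = TodaLU.conj k⁻¹ Y ∧ ψ (Y, Z) = TodaLU.conj u Z) ∧
    -- product structure: the `C` and `D` conjugates of `Λ + 𝔩` present `𝒰` as `C × (Λ + 𝔩)`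
    -- and as `D × (Λ + 𝔩)`
    (∃ α : TodaLU.Mat n → TodaLU.Mat n × TodaLU.Mat n,
      TodaLU.IsRealAnalyticDiffeo (fun p : TodaLU.Mat n × TodaLU.Mat n => TodaLU.conj p.1⁻¹ p.2) α
        (TodaLU.C n ×ˢ TodaLU.affineLower Λ) (TodaLU.domU Λ)) ∧
    (∃ β : TodaLU.Mat n → TodaLU.Mat n × TodaLU.Mat n,
      TodaLU.IsRealAnalyticDiffeo (fun p : TodaLU.Mat n × TodaLU.Mat n => TodaLU.conj p.1 p.2) β
        (TodaLU.D n ×ˢ TodaLU.affineLower Λ) (TodaLU.domU Λ)) ∧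
    -- and the `C` conjugates of a point `Y`, the `D` conjugates of a point `Z`, are the slices of
    -- the product `(Λ + 𝔩) × (Λ + 𝔩)`
    (∀ Y ∈ TodaLU.affineLower Λ,
      TodaLU.phi Λ '' ((fun k => TodaLU.conj k⁻¹ Y) '' TodaLU.C n) =
        {Y} ×ˢ TodaLU.affineLower Λ) ∧
    (∀ Z ∈ TodaLU.affineLower Λ,
      TodaLU.phi Λ '' ((fun u => TodaLU.conj u Z) '' TodaLU.D n) =
        TodaLU.affineLower Λ ×ˢ {Z}) := by
  subst hΛ
  refine ⟨⟨fun p hp => mem_image_of_mem _ hp, TodaLU.injOn_PhiC hd, Subset.rfl⟩,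
    TodaLU.image_PhiD (Matrix.diagonal d) ▸ (TodaLU.injOn_PhiD hd).bijOn_image,
    TodaLU.affineLower_subset_domU hd, TodaLU.exists_isOpen_domU hd,
    TodaLU.conjClass_subset_closure d,
    fun l₁ hl₁ k hk u hu l₂ hl₂ X e₁ e₂ => TodaLU.phi_eq hd hl₁ hk hu hl₂ e₁ e₂,
    TodaLU.bijOn_conj_inv hd, fun l hl => TodaLU.existsUnique_mul hl,
    ⟨TodaLU.psi d, TodaLU.isRealAnalyticDiffeo_phi hd, ?_⟩,
    ⟨_, TodaLU.isRealAnalyticDiffeo_conj_inv hd⟩, ⟨_, TodaLU.isRealAnalyticDiffeo_conj hd⟩,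
    fun Y hY => TodaLU.phi_image_C hd hY, fun Z hZ => TodaLU.phi_image_D hd hZ⟩
  rintro l₁ hl₁ l₂ hl₂ k hk u hu e Y Z rfl rfl
  exact TodaLU.psi_eq hd hl₁ hk hu hl₂ e
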